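/- Let $k$ be a commutative ring and let $d\ge 1$ be an integer. Let $\mathsf P_k$ be the category of finitely generated projective $k$-modules, and for a $k$-module $M$ let $\Gamma^dM=(M^{\otimes d})^{\mathfrak S_d}$. Let $\Gamma^d\mathsf P_k$ be the $k$-linear category with the same objects as $\mathsf P_k$, with morphisms $\Gamma^d\mathrm{Hom}_k(V,W)$ from $V$ to $W$ and with composition induced by that of $\mathsf P_k$; the tensor product over $k$ makes it a monoidal category. Let $\mathsf{Rep}\,\Gamma^d_k$ be the category of strict polynomial functors of degree $d$, i.e. of $k$-linear functors $\Gamma^d\mathsf P_k\to\mathsf{Mod}\,k$, and write $\Gamma^{d,V}=\mathrm{Hom}_{\Gamma^d\mathsf P_k}(V,-)$. For $X$ in $\mathsf{Rep}\,\Gamma^d_k$ let $\mathcal C_X$ be the category of all morphisms $\Gamma^{d,V}\to X$, $V\in\mathsf P_k$ (morphisms being the morphisms of representable functors over $X$). The internal tensor product $\otimes_{\Gamma^d_k}$ on $\mathsf{Rep}\,\Gamma^d_k$ is defined by $$\Gamma^{d,V}\otimes_{\Gamma^d_k}\Gamma^{d,W}=\Gamma^{d,V\otimes_kW},\qquad \Gamma^{d,V}\otimes_{\Gamma^d_k}Y=\operatorname*{colim}_{(\Gamma^{d,W}\to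 Y)\in\mathcal C_Y}\Gamma^{d,V}\otimes_{\Gamma^d_k}\Gamma^{d,W},\qquad X\otimes_{\Gamma^d_k}Y=\operatorname*{colim}_{(\Gamma^{d,V}\to X)\in\mathcal C_X}\Gamma^{d,V}\otimes_{\Gamma^d_k}Y .$$ It makes $\mathsf{Rep}\,\Gamma^d_k$ a monoidal category with unit $I_{\Gamma^d_k}=\Gamma^{d,k}\cong\Gamma^d$. Let $\Gamma^\omega\in\mathsf{Rep}\,\Gamma^d_k$ be the functor $V\mapsto V^{\otimes d}$ (corresponding to the composition $\omega=(1,\dots,1)$ of $d$), on which $\mathfrak S_d$ acts from the right by place permutations $(v_1\otimes\cdots\otimes v_d)\sigma=v_{\sigma(1)}\otimes\cdots\otimes v_{\sigma(d)}$. Precomposition with this action makes $\mathrm{Hom}_{\Gamma^d_k}(\Gamma^\omega,X)$ a left $k\mathfrak S_d$-module for every $X$. Equip the category $k\mathfrak S_d\,\mathsf{Mod}$ with the tensor product $\otimes_k$ with diagonal action of $\mathfrak S_d$, whose unit $I_{k\mathfrak S_d}$ is $k$ with trivial action. Then the functor $$\mathcal F=\mathrm{Hom}_{\Gamma^d_k}(\Gamma^\omega,-)\colon\mathsf{Rep}\,\Gamma^d_k\longrightarrow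 k\mathfrak S_d\,\mathsf{Mod}$$ is (strong) monoidal: there are isomorphisms of $k\mathfrak S_d$-modules $$\mathcal F(X)\otimes_k\mathcal F(Y)\;\cong\;\mathcal F(X\otimes_{\Gamma^d_k}Y),\qquad I_{k\mathfrak S_d}\;\cong\;\mathcal F(I_{\Gamma^d_k}),$$ the first natural in $X$ and $Y$ in $\mathsf{Rep}\,\Gamma^d_k$, which are compatible with the associativity and unit isomorphisms of the two monoidal categories. -/

import Mathlib

open CategoryTheory MonoidalCategory Limits Opposite
open scoped TensorProduct

universe v u

noncomputable section

namespace SPF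

section Powers

variable (k : Type u) [CommRing k] (d : ℕ)

/-- Place permutation on `M^{⊗d}`: `(m₁ ⊗ ⋯ ⊗ m_d) σ = m_{σ(1)} ⊗ ⋯ ⊗ m_{σ(d)}`. -/
def permute (M : Type u) [AddCommGroup M] [Module k M] (σ : Equiv.Perm (Fin d)) :
    (⨂[k] _ : Fin d, M) →ₗ[k] (⨂[k] _ : Fin d, M) :=
  (PiTensorProduct.reindex k (fun _ => M) σ⁻¹).toLinearMap

/-- `Γ^d M`: the submodule of `M^{⊗d}` of tensors invariant under all permutations of the
`d` tensor factors. -/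
def dividedPower (M : Type u) [AddCommGroup M] [Module k M] :
    Submodule k (⨂[k] _ : Fin d, M) where
  carrier := {x | ∀ σ : Equiv.Perm (Fin d), permute k d M σ x = x}
  add_mem' hx hy σ := by rw [map_add, hx σ, hy σ]
  zero_mem' σ := map_zero _
  smul_mem' r x hx σ := by rw [map_smul, hx σ]

variable {k} {M N P : Type u} [AddCommGroup M] [Module k M] [AddCommGroup N] [Module k N]
  [AddCommGroup P] [Module k P]

theorem permute_tprod (σ : Equiv.Perm (Fin d)) (m : Fin d → M) :
    permute k d M σ (PiTensorProduct.tprod k m) = PiTensorProduct.tprod k (fun i => m (σ i)) :=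
  PiTensorProduct.reindex_tprod _ _

/-- The linear map `M^{⊗d} → N^{⊗d} → P^{⊗d}` applying a bilinear map `B` factorwise. -/
def powMap₂ (B : M →ₗ[k] N →ₗ[k] P) :
    (⨂[k] _ : Fin d, M) →ₗ[k] (⨂[k] _ : Fin d, N) →ₗ[k] (⨂[k] _ : Fin d, P) :=
  PiTensorProduct.map₂ (fun _ => B)

theorem powMap₂_tprod (B : M →ₗ[k] N →ₗ[k] P) (m : Fin d → M) (n : Fin d → N) :
    powMap₂ d B (PiTensorProduct.tprod k m) (PiTensorProduct.tprod k n) =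
      PiTensorProduct.tprod k (fun i => B (m i) (n i)) :=
  PiTensorProduct.map₂_tprod_tprod _ _ _

theorem permute_powMap₂ (B : M →ₗ[k] N →ₗ[k] P) (σ : Equiv.Perm (Fin d))
    (x : ⨂[k] _ : Fin d, M) (y : ⨂[k] _ : Fin d, N) :
    permute k d P σ (powMap₂ d B x y) =
      powMap₂ d B (permute k d M σ x) (permute k d N σ y) := by
  induction x using PiTensorProduct.induction_on with
  | add x₁ x₂ h₁ h₂ => simp only [map_add, LinearMap.add_apply, h₁, h₂]
  | smul_tprod r a =>
    induction y using PiTensorProduct.induction_on with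
    | add y₁ y₂ h₁ h₂ => simp only [map_add, h₁, h₂]
    | smul_tprod s b =>
      simp only [map_smul, LinearMap.smul_apply, powMap₂_tprod, permute_tprod]

theorem powMap₂_mem (B : M →ₗ[k] N →ₗ[k] P) {x : ⨂[k] _ : Fin d, M} {y : ⨂[k] _ : Fin d, N}
    (hx : x ∈ dividedPower k d M) (hy : y ∈ dividedPower k d N) :
    powMap₂ d B x y ∈ dividedPower k d P := fun σ => by
  rw [permute_powMap₂, hx σ, hy σ]

theorem tprod_mem (m : M) :
    PiTensorProduct.tprod k (fun _ : Fin d => m) ∈ dividedPower k d M := fun σ => by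
  rw [permute_tprod]

end Powers

/-- Objects of the category of degree `d` divided powers `Γ^d D` of a `k`-linear category `D`:
the same objects as `D`. -/
structure GammaCat (k : Type u) (d : ℕ) (D : Type v) where
  /-- the underlying object of `D` -/
  as : D

namespace GammaCat

variable {k : Type u} [CommRing k] {d : ℕ} {D : Type v} [Category.{u} D] [Preadditive D]
  [Linear k D]

/-- The bilinear composition map `(f, g) ↦ g ∘ f` on Hom modules. -/
def compBilin (U V W : D) : (U ⟶ V) →ₗ[k] (V ⟶ W) →ₗ[k] (U ⟶ W) :=
  Linear.comp U V W

theorem compBilin_apply {U V W : D} (f : U ⟶ V) (g : V ⟶ W) :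
    compBilin (k := k) U V W f g = f ≫ g := rfl

/-- Morphisms `V ⟶ W` in `Γ^d D` are the elements of `Γ^d Hom(V, W)`; composition is induced by
factorwise composition. -/
instance : Category.{u} (GammaCat k d D) where
  Hom V W := dividedPower k d (V.as ⟶ W.as)
  id V := ⟨PiTensorProduct.tprod k (fun _ => 𝟙 V.as), tprod_mem d _⟩
  comp {U V W} f g := ⟨powMap₂ d (compBilin (k := k) U.as V.as W.as) f.1 g.1,
    powMap₂_mem d _ f.2 g.2⟩
  id_comp {V W} f := Subtype.ext <| by
    show powMap₂ d _ _ f.1 = f.1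
    generalize f.1 = x
    induction x using PiTensorProduct.induction_on with
    | add x₁ x₂ h₁ h₂ => rw [map_add, h₁, h₂]
    | smul_tprod r a =>
      rw [map_smul, powMap₂_tprod]
      simp [compBilin_apply]
  comp_id {V W} f := Subtype.ext <| by
    show powMap₂ d _ f.1 _ = f.1
    generalize f.1 = x
    induction x using PiTensorProduct.induction_on with
    | add x₁ x₂ h₁ h₂ => rw [map_add, LinearMap.add_apply, h₁, h₂]
    | smul_tprod r a =>
      rw [map_smul, LinearMap.smul_apply, powMap₂_tprod]
      simp [compBilin_apply]
  assoc {V W X Y} f g h := Subtype.ext <| by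
    show powMap₂ d _ (powMap₂ d _ f.1 g.1) h.1 = powMap₂ d _ f.1 (powMap₂ d _ g.1 h.1)
    generalize f.1 = x
    generalize g.1 = y
    generalize h.1 = z
    induction x using PiTensorProduct.induction_on with
    | add x₁ x₂ h₁ h₂ => simp only [map_add, LinearMap.add_apply, h₁, h₂]
    | smul_tprod r a =>
    induction y using PiTensorProduct.induction_on with
    | add x₁ x₂ h₁ h₂ => simp only [map_add, LinearMap.add_apply, h₁, h₂]
    | smul_tprod s b =>
    induction z using PiTensorProduct.induction_on with
    | add x₁ x₂ h₁ h₂ => simp only [map_add, h₁, h₂]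
    | smul_tprod t c =>
      simp only [map_smul, LinearMap.smul_apply, powMap₂_tprod,
        compBilin_apply, Category.assoc]

theorem comp_val {U V W : GammaCat k d D} (f : U ⟶ V) (g : V ⟶ W) :
    (f ≫ g).1 = powMap₂ d (compBilin (k := k) U.as V.as W.as) f.1 g.1 := rfl

instance : Preadditive (GammaCat k d D) where
  homGroup V W := inferInstanceAs (AddCommGroup (dividedPower k d (V.as ⟶ W.as)))
  add_comp U V W f g h := Subtype.ext <| by
    exact (congrArg (fun l => l h.1)
      (map_add (powMap₂ d (compBilin (k := k) U.as V.as W.as)) f.1 g.1) :)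
  comp_add U V W f g h := Subtype.ext <|
    map_add (powMap₂ d (compBilin (k := k) U.as V.as W.as) f.1) g.1 h.1

instance : Linear k (GammaCat k d D) where
  homModule V W := inferInstanceAs (Module k (dividedPower k d (V.as ⟶ W.as)))
  smul_comp U V W r f g := Subtype.ext <|
    congrArg (fun l => l g.1)
      (map_smul (powMap₂ d (compBilin (k := k) U.as V.as W.as)) r f.1)
  comp_smul U V W f r g := Subtype.ext <|
    map_smul (powMap₂ d (compBilin (k := k) U.as V.as W.as) f.1) r g.1

variable (k d D) in
/-- The functor `D ⥤ Γ^d D`, identity on objects and `f ↦ f ⊗ ⋯ ⊗ f` on morphisms. -/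
def γ : D ⥤ GammaCat k d D where
  obj V := ⟨V⟩
  map f := ⟨PiTensorProduct.tprod k (fun _ => f), tprod_mem d _⟩
  map_id _ := rfl
  map_comp f g := Subtype.ext <| by
    show PiTensorProduct.tprod k (fun _ => f ≫ g) = powMap₂ d (compBilin (k := k) _ _ _)
      (PiTensorProduct.tprod k fun _ => f) (PiTensorProduct.tprod k fun _ => g)
    rw [powMap₂_tprod]
    rfl

theorem γ_map_val {V W : D} (f : V ⟶ W) :
    ((γ k d D).map f).1 = PiTensorProduct.tprod k (fun _ => f) := rfl

theorem id_val (V : GammaCat k d D) :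
    (𝟙 V : V ⟶ V).1 = PiTensorProduct.tprod k (fun _ => 𝟙 V.as) := rfl

section Monoidal

variable [MonoidalCategory D] [MonoidalPreadditive D] [MonoidalLinear k D]

/-- The bilinear map `(f, g) ↦ f ⊗ g` on Hom modules. -/
def tensorBilin (V V' W W' : D) :
    (V ⟶ V') →ₗ[k] (W ⟶ W') →ₗ[k] (V ⊗ W ⟶ V' ⊗ W') :=
  LinearMap.mk₂ k (fun f g => f ⊗ₘ g)
    (fun f f' g => by simp [MonoidalPreadditive.add_tensor])
    (fun r f g => by simp [MonoidalCategory.tensorHom_def])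
    (fun f g g' => by simp [MonoidalPreadditive.tensor_add])
    (fun r f g => by simp [MonoidalCategory.tensorHom_def])

theorem tensorBilin_apply {V V' W W' : D} (f : V ⟶ V') (g : W ⟶ W') :
    tensorBilin (k := k) V V' W W' f g = f ⊗ₘ g := rfl

/-- The tensor product on `Γ^d D`: that of `D` on objects, and on morphisms
`Γ^d Hom(V,V') × Γ^d Hom(W,W') → Γ^d Hom(V ⊗ W, V' ⊗ W')` induced by
`(f, g) ↦ f ⊗ g` factorwise. -/
instance (priority := 10) : MonoidalCategoryStruct (GammaCat k d D) where
  tensorObj V W := ⟨V.as ⊗ W.as⟩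
  tensorHom {V V' W W'} f g := ⟨powMap₂ d (tensorBilin V.as V'.as W.as W'.as) f.1 g.1,
    powMap₂_mem d _ f.2 g.2⟩
  whiskerLeft V {W W'} g := ⟨powMap₂ d (tensorBilin V.as V.as W.as W'.as) (𝟙 V : V ⟶ V).1 g.1,
    powMap₂_mem d _ (𝟙 V : V ⟶ V).2 g.2⟩
  whiskerRight {V V'} f W := ⟨powMap₂ d (tensorBilin V.as V'.as W.as W.as) f.1 (𝟙 W : W ⟶ W).1,
    powMap₂_mem d _ f.2 (𝟙 W : W ⟶ W).2⟩
  tensorUnit := ⟨𝟙_ D⟩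
  associator U V W := (γ k d D).mapIso (α_ U.as V.as W.as)
  leftUnitor V := (γ k d D).mapIso (λ_ V.as)
  rightUnitor V := (γ k d D).mapIso (ρ_ V.as)

theorem tensorHom_val {V V' W W' : GammaCat k d D} (f : V ⟶ V') (g : W ⟶ W') :
    (f ⊗ₘ g).1 = powMap₂ d (tensorBilin V.as V'.as W.as W'.as) f.1 g.1 := rfl

theorem associator_val (U V W : GammaCat k d D) :
    (α_ U V W).hom.1 = PiTensorProduct.tprod k (fun _ => (α_ U.as V.as W.as).hom) := rfl

theorem leftUnitor_val (V : GammaCat k d D) :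
    (λ_ V).hom.1 = PiTensorProduct.tprod k (fun _ => (λ_ V.as).hom) := rfl

theorem rightUnitor_val (V : GammaCat k d D) :
    (ρ_ V).hom.1 = PiTensorProduct.tprod k (fun _ => (ρ_ V.as).hom) := rfl

theorem unit_id_val :
    (𝟙 (𝟙_ (GammaCat k d D)) : 𝟙_ (GammaCat k d D) ⟶ _).1 =
      PiTensorProduct.tprod k (fun _ => 𝟙 (𝟙_ D)) := rfl

theorem γ_tensor {V V' W W' : D} (f : V ⟶ V') (g : W ⟶ W') :
    (γ k d D).map f ⊗ₘ (γ k d D).map g = (γ k d D).map (f ⊗ₘ g) := Subtype.ext <| by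
  rw [tensorHom_val]
  exact powMap₂_tprod _ _ _ _

instance : MonoidalCategory (GammaCat k d D) :=
  MonoidalCategory.ofTensorHom
    (id_tensorHom_id := fun V W => Subtype.ext <| by
      rw [tensorHom_val, id_val, id_val]
      refine (powMap₂_tprod _ _ _ _).trans ?_
      simp only [tensorBilin_apply, id_tensorHom_id]
      rfl)
    (id_tensorHom := fun _ _ _ _ => rfl)
    (tensorHom_id := fun _ _ => rfl)
    (tensorHom_comp_tensorHom := fun {X₁ Y₁ Z₁ X₂ Y₂ Z₂} f₁ f₂ g₁ g₂ => Subtype.ext <| by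
      rw [comp_val, tensorHom_val, tensorHom_val, tensorHom_val, comp_val, comp_val]
      generalize f₁.1 = x
      generalize f₂.1 = y
      generalize g₁.1 = z
      generalize g₂.1 = w
      induction x using PiTensorProduct.induction_on with
      | add x₁ x₂ h₁ h₂ => simp only [map_add, LinearMap.add_apply, h₁, h₂]
      | smul_tprod r a =>
      induction y using PiTensorProduct.induction_on with
      | add x₁ x₂ h₁ h₂ => simp only [map_add, LinearMap.add_apply, h₁, h₂]
      | smul_tprod s b =>
      induction z using PiTensorProduct.induction_on with
      | add x₁ x₂ h₁ h₂ => simp only [map_add, LinearMap.add_apply, h₁, h₂]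
      | smul_tprod t c =>
      induction w using PiTensorProduct.induction_on with
      | add x₁ x₂ h₁ h₂ => simp only [map_add, h₁, h₂]
      | smul_tprod q e =>
        simp only [map_smul, LinearMap.smul_apply, powMap₂_tprod, tensorBilin_apply,
          compBilin_apply, smul_smul]
        congr 1
        · ring
        · congr 1
          funext i
          exact MonoidalCategory.tensorHom_comp_tensorHom _ _ _ _)
    (associator_naturality := fun {X₁ X₂ X₃ Y₁ Y₂ Y₃} f₁ f₂ f₃ => Subtype.ext <| by
      rw [comp_val, tensorHom_val, tensorHom_val, comp_val, tensorHom_val, tensorHom_val,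
        associator_val, associator_val]
      generalize f₁.1 = x
      generalize f₂.1 = y
      generalize f₃.1 = z
      induction x using PiTensorProduct.induction_on with
      | add x₁ x₂ h₁ h₂ => simp only [map_add, LinearMap.add_apply, h₁, h₂]
      | smul_tprod r a =>
      induction y using PiTensorProduct.induction_on with
      | add x₁ x₂ h₁ h₂ => simp only [map_add, LinearMap.add_apply, h₁, h₂]
      | smul_tprod s b =>
      induction z using PiTensorProduct.induction_on with
      | add x₁ x₂ h₁ h₂ => simp only [map_add, LinearMap.add_apply, h₁, h₂]
      | smul_tprod t c =>
        simp only [map_smul, LinearMap.smul_apply, powMap₂_tprod, tensorBilin_apply,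
          compBilin_apply]
        congr 4
        funext i
        exact MonoidalCategory.associator_naturality _ _ _)
    (leftUnitor_naturality := fun {X Y} f => Subtype.ext <| by
      rw [comp_val, tensorHom_val, comp_val, leftUnitor_val, leftUnitor_val, unit_id_val]
      generalize f.1 = x
      induction x using PiTensorProduct.induction_on with
      | add x₁ x₂ h₁ h₂ => simp only [map_add, LinearMap.add_apply, h₁, h₂]
      | smul_tprod r a =>
        simp only [map_smul, LinearMap.smul_apply, powMap₂_tprod, tensorBilin_apply,
          compBilin_apply]
        congr 2
        funext i
        exact (by simp : (𝟙 (𝟙_ D) ⊗ₘ a i) ≫ (λ_ Y.as).hom = (λ_ X.as).hom ≫ a i))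
    (rightUnitor_naturality := fun {X Y} f => Subtype.ext <| by
      rw [comp_val, tensorHom_val, comp_val, rightUnitor_val, rightUnitor_val, unit_id_val]
      generalize f.1 = x
      induction x using PiTensorProduct.induction_on with
      | add x₁ x₂ h₁ h₂ => simp only [map_add, LinearMap.add_apply, h₁, h₂]
      | smul_tprod r a =>
        simp only [map_smul, LinearMap.smul_apply, powMap₂_tprod, tensorBilin_apply,
          compBilin_apply]
        congr 2
        funext i
        exact (by simp : (a i ⊗ₘ 𝟙 (𝟙_ D)) ≫ (ρ_ Y.as).hom = (ρ_ X.as).hom ≫ a i))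
    (pentagon := fun W X Y Z => by
      have h := congrArg (γ k d D).map (MonoidalCategory.pentagon W.as X.as Y.as Z.as)
      simp only [Functor.map_comp, ← id_tensorHom, ← tensorHom_id, ← γ_tensor] at h
      exact h)
    (triangle := fun X Y => by
      have h := congrArg (γ k d D).map (MonoidalCategory.triangle X.as Y.as)
      simp only [Functor.map_comp, ← id_tensorHom, ← tensorHom_id, ← γ_tensor] at h
      exact h)

instance : MonoidalPreadditive (GammaCat k d D) where
  whiskerLeft_zero {X Y Z} := Subtype.ext <|
    map_zero (powMap₂ d (tensorBilin X.as X.as Y.as Z.as) (𝟙 X : X ⟶ X).1)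
  zero_whiskerRight {X Y Z} := Subtype.ext <|
    congrArg (fun l => l (𝟙 X : X ⟶ X).1)
      (map_zero (powMap₂ d (tensorBilin Y.as Z.as X.as X.as)))
  whiskerLeft_add {X Y Z} f g := Subtype.ext <|
    map_add (powMap₂ d (tensorBilin X.as X.as Y.as Z.as) (𝟙 X : X ⟶ X).1) f.1 g.1
  add_whiskerRight {X Y Z} f g := Subtype.ext <|
    congrArg (fun l => l (𝟙 X : X ⟶ X).1)
      (map_add (powMap₂ d (tensorBilin Y.as Z.as X.as X.as)) f.1 g.1)

instance : MonoidalLinear k (GammaCat k d D) where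
  whiskerLeft_smul X Y Z r f := Subtype.ext <|
    map_smul (powMap₂ d (tensorBilin X.as X.as Y.as Z.as) (𝟙 X : X ⟶ X).1) r f.1
  smul_whiskerRight r {Y Z} f X := Subtype.ext <|
    congrArg (fun l => l (𝟙 X : X ⟶ X).1)
      (map_smul (powMap₂ d (tensorBilin Y.as Z.as X.as X.as)) r f.1)

end Monoidal

end GammaCat

section LinRep

variable (k : Type u) [CommRing k] (C : Type v) [Category.{u} C] [Preadditive C] [Linear k C]

/-- The property of a functor `C ⥤ Mod k` of being `k`-linear on Hom modules. -/
def isLinear : ObjectProperty (C ⥤ ModuleCat.{u} k) :=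
  fun X => ∃ _ : X.Additive, X.Linear k

/-- The category of `k`-linear representations of `C`: `k`-linear functors to `k`-modules, with all
natural transformations as morphisms. -/
abbrev LinRep := (isLinear k C).FullSubcategory

variable {k C}

theorem LinRep.map_add' (X : LinRep k C) {V W : C} (f g : V ⟶ W) :
    X.obj.map (f + g) = X.obj.map f + X.obj.map g :=
  X.property.1.map_add

theorem LinRep.map_smul' (X : LinRep k C) {V W : C} (r : k) (f : V ⟶ W) :
    X.obj.map (r • f) = r • X.obj.map f :=
  X.property.2.map_smul f r

instance (J : Type*) [Category J] [HasColimitsOfShape J (ModuleCat.{u} k)] :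
    (isLinear k C).IsClosedUnderColimitsOfShape J where
  colimitsOfShape_le X := by
    rintro ⟨⟨⟨D, ι, hι⟩, hD⟩⟩
    have key : ∀ V : C, IsColimit (((evaluation C (ModuleCat.{u} k)).obj V).mapCocone
        (Cocone.mk X ι)) := fun V => isColimitOfPreserves _ hι
    have hadd : X.Additive := by
      constructor
      intro V W f g
      refine (key V).hom_ext fun j => ?_
      have h : ∀ f : V ⟶ W, (ι.app j).app V ≫ X.map f = (D.obj j).map f ≫ (ι.app j).app W :=
        fun f => ((ι.app j).naturality f).symm
      have := (hD j).1
      show (ι.app j).app V ≫ _ = (ι.app j).app V ≫ _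
      simp only [Preadditive.comp_add, h, Functor.map_add, Preadditive.add_comp]
    refine ⟨hadd, ⟨fun {V W} f r => ?_⟩⟩
    refine (key V).hom_ext fun j => ?_
    have h : ∀ f : V ⟶ W, (ι.app j).app V ≫ X.map f = (D.obj j).map f ≫ (ι.app j).app W :=
      fun f => ((ι.app j).naturality f).symm
    have := (hD j).1
    have := (hD j).2
    show (ι.app j).app V ≫ _ = (ι.app j).app V ≫ _
    simp only [Linear.comp_smul, h, Functor.map_smul, Linear.smul_comp]

variable (k C) in
/-- The representable functors: `V ↦ Hom(V, -)`. -/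
def rep : Cᵒᵖ ⥤ LinRep k C :=
  (isLinear k C).lift (linearCoyoneda k C) fun V =>
    ⟨inferInstance, ⟨fun f r => by ext g; exact Linear.comp_smul _ _ _ g r f⟩⟩

instance [EssentiallySmall.{u} C] : LocallySmall.{u} (C ⥤ ModuleCat.{u} k) :=
  locallySmall_of_faithful
    ((Functor.whiskeringLeft _ _ (ModuleCat.{u} k)).obj (equivSmallModel.{u} C).inverse)

instance [EssentiallySmall.{u} C] : LocallySmall.{u} (LinRep k C) :=
  locallySmall_of_faithful (isLinear k C).ι

instance [EssentiallySmall.{u} C] (X : LinRep k C) :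
    HasColimitsOfShape (CostructuredArrow (rep k C) X) (ModuleCat.{u} k) :=
  hasColimitsOfShape_of_essentiallySmall.{u, u} _ _

section Tensor

variable [EssentiallySmall.{u} C] [MonoidalCategory C]

/-- For `Y` in `LinRep k C`, the functor `V ↦ Hom(V, -) ⊗ Y`, where
`Hom(V, -) ⊗ Y = colim Hom(V ⊗ W, -)`, the colimit running over the category of all morphisms
`Hom(W, -) ⟶ Y` from representable functors to `Y`. -/
def repTensor (Y : LinRep k C) : Cᵒᵖ ⥤ LinRep k C :=
  curriedTensor Cᵒᵖ ⋙ (Functor.whiskeringRight _ _ _).obj (rep k C) ⋙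
    (Functor.whiskeringLeft _ _ _).obj (CostructuredArrow.proj (rep k C) Y) ⋙ colim

/-- The internal tensor product `X ⊗ Y = colim (Hom(V, -) ⊗ Y)`, the colimit running over the
category of all morphisms `Hom(V, -) ⟶ X` from representable functors to `X`. -/
def tensor (X Y : LinRep k C) : LinRep k C :=
  colimit (CostructuredArrow.proj (rep k C) X ⋙ repTensor Y)

end Tensor
end LinRep

section API

variable {k : Type u} [CommRing k] {C : Type v} [Category.{u} C] [Preadditive C] [Linear k C]

namespace LinRep

/-- The action of a morphism on an element. -/
def act (X : LinRep k C) {V W : C} (f : V ⟶ W) (x : X.obj.obj V) : X.obj.obj W :=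
  (X.obj.map f).hom x

/-- The value of a morphism of representations on an element. -/
def ap {X Y : LinRep k C} (φ : X ⟶ Y) {V : C} (x : X.obj.obj V) : Y.obj.obj V :=
  (φ.hom.app V).hom x

variable {X Y Z : LinRep k C} {U V W : C}

theorem act_id (x : X.obj.obj V) : X.act (𝟙 V) x = x := by
  rw [act, X.obj.map_id]; rfl

theorem act_comp (f : U ⟶ V) (g : V ⟶ W) (x : X.obj.obj U) :
    X.act (f ≫ g) x = X.act g (X.act f x) := by
  rw [act, X.obj.map_comp]; rfl

theorem act_add (f : U ⟶ V) (x y : X.obj.obj U) : X.act f (x + y) = X.act f x + X.act f y :=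
  map_add _ _ _

theorem act_smul (f : U ⟶ V) (r : k) (x : X.obj.obj U) : X.act f (r • x) = r • X.act f x :=
  map_smul _ _ _

theorem add_act (f g : U ⟶ V) (x : X.obj.obj U) : X.act (f + g) x = X.act f x + X.act g x := by
  rw [act, X.map_add']; rfl

theorem smul_act (r : k) (f : U ⟶ V) (x : X.obj.obj U) : X.act (r • f) x = r • X.act f x := by
  rw [act, X.map_smul']; rfl

theorem zero_act (x : X.obj.obj U) : X.act (0 : U ⟶ V) x = 0 := by
  have := smul_act (X := X) (0 : k) (0 : U ⟶ V) x
  rwa [zero_smul, zero_smul] at this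

theorem ap_act (φ : X ⟶ Y) (f : V ⟶ W) (x : X.obj.obj V) :
    ap φ (X.act f x) = Y.act f (ap φ x) :=
  congrArg (fun l => l.hom x) (φ.hom.naturality f)

theorem ap_id (x : X.obj.obj V) : ap (𝟙 X) x = x := rfl

theorem ap_comp (φ : X ⟶ Y) (ψ : Y ⟶ Z) (x : X.obj.obj V) : ap (φ ≫ ψ) x = ap ψ (ap φ x) := rfl

theorem ap_add (φ : X ⟶ Y) (x y : X.obj.obj V) : ap φ (x + y) = ap φ x + ap φ y :=
  map_add _ _ _

theorem ap_smul (φ : X ⟶ Y) (r : k) (x : X.obj.obj V) : ap φ (r • x) = r • ap φ x :=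
  map_smul _ _ _

theorem hom_ext {φ ψ : X ⟶ Y} (h : ∀ (V : C) (x : X.obj.obj V), ap φ x = ap ψ x) : φ = ψ := by
  apply ObjectProperty.hom_ext
  ext V x
  exact h V x

/-- A natural family of linear maps is a morphism of representations. -/
def ofLinear (f : ∀ V, X.obj.obj V →ₗ[k] Y.obj.obj V)
    (hf : ∀ {V W : C} (g : V ⟶ W) (x : X.obj.obj V), f W (X.act g x) = Y.act g (f V x)) : X ⟶ Y :=
  ObjectProperty.homMk
    { app := fun V => ModuleCat.ofHom (f V)
      naturality := fun V W g => by ext x; exact hf g x }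

/-- The morphism from a representable functor corresponding to an element. -/
def yon (x : X.obj.obj V) : (rep k C).obj (op V) ⟶ X :=
  ofLinear (fun W =>
    { toFun := fun g => X.act (show V ⟶ W from g) x
      map_add' := fun _ _ => add_act _ _ x
      map_smul' := fun _ _ => smul_act _ _ x })
    (fun _ _ => act_comp _ _ x)

theorem ap_yon (x : X.obj.obj V) (g : V ⟶ W) : ap (yon x) (V := W) g = X.act g x := rfl

/-- The element corresponding to a morphism from a representable functor. -/
def ev {A : Cᵒᵖ} (φ : (rep k C).obj A ⟶ X) : X.obj.obj A.unop := ap φ (V := A.unop) (𝟙 A.unop)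

theorem rep_act (A : Cᵒᵖ) (g : A.unop ⟶ V) (h : V ⟶ W) :
    ((rep k C).obj A).act h g = g ≫ h := rfl

theorem ap_rep_map {A B : Cᵒᵖ} (f : A ⟶ B) (g : A.unop ⟶ V) :
    ap ((rep k C).map f) g = f.unop ≫ g := rfl

theorem ap_eq_act_ev {A : Cᵒᵖ} (φ : (rep k C).obj A ⟶ X) (g : A.unop ⟶ V) :
    ap φ (V := V) g = X.act g (ev φ) :=
  (congrArg (fun t => ap φ (V := V) t) (Category.id_comp g).symm).trans
    (ap_act φ g (show ((rep k C).obj A).obj.obj A.unop from 𝟙 A.unop))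

theorem ev_ext {A : Cᵒᵖ} {φ ψ : (rep k C).obj A ⟶ X} (h : ev φ = ev ψ) : φ = ψ :=
  hom_ext fun V g => by
    have h1 := ap_eq_act_ev φ g
    rw [h, ← ap_eq_act_ev ψ g] at h1
    exact h1

theorem ev_yon (x : X.obj.obj V) : ev (yon x) = x := act_id x

theorem ev_comp {A : Cᵒᵖ} (φ : (rep k C).obj A ⟶ X) (ψ : X ⟶ Y) : ev (φ ≫ ψ) = ap ψ (ev φ) := rfl

theorem ev_rep_map {A B : Cᵒᵖ} (f : A ⟶ B) (φ : (rep k C).obj B ⟶ X) :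
    ev ((rep k C).map f ≫ φ) = X.act f.unop (ev φ) :=
  (congrArg (fun t => ap φ (V := A.unop) t) (Category.comp_id f.unop)).trans (ap_eq_act_ev φ f.unop)

/-- The object of the indexing category of the colimit given by an element. -/
def elt (x : X.obj.obj V) : CostructuredArrow (rep k C) X :=
  CostructuredArrow.mk (S := rep k C) (Y := op V) (yon x)

theorem rep_map_yon (f : V ⟶ W) (x : X.obj.obj V) :
    (rep k C).map f.op ≫ yon x = yon (X.act f x) :=
  ev_ext (by rw [ev_rep_map, ev_yon, ev_yon]; rfl)

theorem elt_surj (F : CostructuredArrow (rep k C) X) :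
    ∃ (V : C) (x : X.obj.obj V), F = elt x := by
  obtain ⟨A, g, rfl⟩ := F.mk_surjective
  have h : g = yon (ev g) := ev_ext (ev_yon _).symm
  exact ⟨A.unop, ev g, congrArg (CostructuredArrow.mk (S := rep k C) (Y := A)) h⟩

section Tensor

variable [EssentiallySmall.{u} C] [MonoidalCategory C]

/-- The diagram whose colimit is `Hom(V, -) ⊗ Y`. -/
abbrev innerDiag (Y : LinRep k C) (A : Cᵒᵖ) : CostructuredArrow (rep k C) Y ⥤ LinRep k C :=
  CostructuredArrow.proj (rep k C) Y ⋙
    (curriedTensor Cᵒᵖ ⋙ (Functor.whiskeringRight _ _ _).obj (rep k C)).obj A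

/-- The structure maps of the colimit `Hom(V, -) ⊗ Y`. -/
def innerι (V : C) (y : Y.obj.obj W) : (rep k C).obj (op (V ⊗ W)) ⟶ (repTensor Y).obj (op V) :=
  colimit.ι (innerDiag Y (op V)) (elt y)

/-- The structure maps of the colimit `X ⊗ Y`. -/
def outerι (Y : LinRep k C) (x : X.obj.obj V) : (repTensor Y).obj (op V) ⟶ tensor X Y :=
  colimit.ι (CostructuredArrow.proj (rep k C) X ⋙ repTensor Y) (elt x)

theorem innerι_act (V : C) {W' : C} (f : W ⟶ W') (y : Y.obj.obj W) :
    innerι V (Y.act f y) = (rep k C).map (V ◁ f).op ≫ innerι V y :=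
  (colimit.w (innerDiag Y (op V))
    (CostructuredArrow.homMk f.op (rep_map_yon f y) : elt (Y.act f y) ⟶ elt y)).symm

theorem innerι_map {V' : C} (f : V ⟶ V') (y : Y.obj.obj W) :
    innerι V' y ≫ (repTensor Y).map f.op = (rep k C).map (f ▷ W).op ≫ innerι V y :=
  ι_colimMap (Functor.whiskerLeft (CostructuredArrow.proj (rep k C) Y)
    ((curriedTensor Cᵒᵖ ⋙ (Functor.whiskeringRight _ _ _).obj (rep k C)).map f.op)) (elt y)

theorem outerι_act {V' : C} (f : V ⟶ V') (x : X.obj.obj V) :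
    outerι Y (X.act f x) = (repTensor Y).map f.op ≫ outerι Y x :=
  (colimit.w (CostructuredArrow.proj (rep k C) X ⋙ repTensor Y)
    (CostructuredArrow.homMk f.op (rep_map_yon f x) : elt (X.act f x) ⟶ elt x)).symm

theorem inner_ext {φ ψ : (repTensor Y).obj (op V) ⟶ Z}
    (h : ∀ (W : C) (y : Y.obj.obj W), ev (innerι V y ≫ φ) = ev (innerι V y ≫ ψ)) : φ = ψ := by
  refine colimit.hom_ext (F := innerDiag Y (op V)) fun G => ?_
  obtain ⟨W, y, rfl⟩ := elt_surj G
  exact ev_ext (A := op (V ⊗ W)) (h W y)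

theorem outer_ext {φ ψ : tensor X Y ⟶ Z}
    (h : ∀ (V : C) (x : X.obj.obj V), outerι Y x ≫ φ = outerι Y x ≫ ψ) : φ = ψ := by
  refine colimit.hom_ext fun G => ?_
  obtain ⟨V, x, rfl⟩ := elt_surj G
  exact h V x

/-- Morphisms out of the colimit `Hom(V, -) ⊗ Y`. -/
def innerDesc (V : C) (c : ∀ W : C, Y.obj.obj W → Z.obj.obj (V ⊗ W))
    (hc : ∀ {W W' : C} (f : W ⟶ W') (y : Y.obj.obj W), c W' (Y.act f y) = Z.act (V ◁ f) (c W y)) :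
    (repTensor Y).obj (op V) ⟶ Z :=
  colimit.desc (innerDiag Y (op V))
    { pt := Z
      ι :=
        { app := fun G => yon (V := V ⊗ G.left.unop) (c _ (ev G.hom))
          naturality := fun G G' f => by
            refine Eq.trans ?_ (Category.comp_id _).symm
            have h1 : ev G.hom = Y.act f.left.unop (ev G'.hom) := by
              rw [← ev_rep_map, CostructuredArrow.w]
            refine ev_ext (A := op (V ⊗ G.left.unop)) ?_
            refine (ev_rep_map (A := op (V ⊗ G.left.unop)) (B := op (V ⊗ G'.left.unop))
              (V ◁ f.left.unop).op _).trans ?_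
            rw [ev_yon, ev_yon, h1, hc]
            rfl } }

theorem innerι_desc (c : ∀ W : C, Y.obj.obj W → Z.obj.obj (V ⊗ W))
    (hc : ∀ {W W' : C} (f : W ⟶ W') (y : Y.obj.obj W), c W' (Y.act f y) = Z.act (V ◁ f) (c W y))
    (y : Y.obj.obj W) : innerι V y ≫ innerDesc V c hc = yon (c W y) := by
  refine (colimit.ι_desc (F := innerDiag Y (op V)) _ (elt y)).trans ?_
  exact congrArg (fun t => yon (V := V ⊗ W) (c W t)) (ev_yon y)

/-- The canonical element `x ⊗ y` of `(X ⊗ Y)(V ⊗ W)` for `x` in `X(V)` and `y` in `Y(W)`. -/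
def tmul (x : X.obj.obj V) (y : Y.obj.obj W) : (tensor X Y).obj.obj (V ⊗ W) :=
  ev (innerι V y ≫ outerι Y x)

theorem act_tmul_left {V' : C} (f : V ⟶ V') (x : X.obj.obj V) (y : Y.obj.obj W) :
    (tensor X Y).act (f ▷ W) (tmul x y) = tmul (X.act f x) y := by
  rw [tmul, tmul, outerι_act, ← Category.assoc, innerι_map, Category.assoc, ev_rep_map]
  rfl

theorem act_tmul_right {W' : C} (f : W ⟶ W') (x : X.obj.obj V) (y : Y.obj.obj W) :
    (tensor X Y).act (V ◁ f) (tmul x y) = tmul x (Y.act f y) := by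
  rw [tmul, tmul, innerι_act, Category.assoc, ev_rep_map]
  rfl

theorem tensor_hom_ext {φ ψ : tensor X Y ⟶ Z}
    (h : ∀ (V W : C) (x : X.obj.obj V) (y : Y.obj.obj W), ap φ (tmul x y) = ap ψ (tmul x y)) :
    φ = ψ :=
  outer_ext fun V x => inner_ext fun W y => by
    rw [← Category.assoc, ← Category.assoc, ev_comp, ev_comp]
    exact h V W x y

end Tensor

/-- A family of maps `X(V) × Y(W) → Z(V ⊗ W)` natural in `V` and in `W`. -/
structure BiNat [MonoidalCategory C] (X Y Z : LinRep k C) where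
  /-- the maps -/
  map : ∀ V W : C, X.obj.obj V → Y.obj.obj W → Z.obj.obj (V ⊗ W)
  left : ∀ {V V' W : C} (f : V ⟶ V') (x : X.obj.obj V) (y : Y.obj.obj W),
    map V' W (X.act f x) y = Z.act (f ▷ W) (map V W x y)
  right : ∀ {V W W' : C} (f : W ⟶ W') (x : X.obj.obj V) (y : Y.obj.obj W),
    map V W' x (Y.act f y) = Z.act (V ◁ f) (map V W x y)

section Tensor

variable [EssentiallySmall.{u} C] [MonoidalCategory C]

/-- Universal property of the internal tensor product. -/
def desc (b : BiNat X Y Z) : tensor X Y ⟶ Z :=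
  colimit.desc (CostructuredArrow.proj (rep k C) X ⋙ repTensor Y)
    { pt := Z
      ι :=
        { app := fun F => innerDesc F.left.unop (fun W y => b.map _ W (ev F.hom) y)
            (fun f y => b.right f _ y)
          naturality := fun F F' f => by
            refine Eq.trans ?_ (Category.comp_id _).symm
            have h1 : ev F.hom = X.act f.left.unop (ev F'.hom) := by
              rw [← ev_rep_map, CostructuredArrow.w]
            refine inner_ext (V := F.left.unop) fun W y => ?_
            refine Eq.trans ?_ (congrArg ev (innerι_desc _ _ _).symm)
            refine (congrArg ev ((Category.assoc _ _ _).symm.trans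
              (congrArg (· ≫ innerDesc F'.left.unop (fun W y => b.map _ W (ev F'.hom) y)
                (fun f y => b.right f _ y)) (innerι_map f.left.unop y)))).trans ?_
            rw [Category.assoc, innerι_desc, ev_rep_map, ev_yon, ev_yon, h1, b.left]
            rfl } }

theorem desc_tmul (b : BiNat X Y Z) (x : X.obj.obj V) (y : Y.obj.obj W) :
    ap (desc b) (tmul x y) = b.map V W x y := by
  have h : outerι Y x ≫ desc b = innerDesc V (fun W y => b.map V W (ev (yon x)) y)
      (fun f y => b.right f _ y) := colimit.ι_desc _ (elt x)
  rw [tmul, ← ev_comp, Category.assoc, h, innerι_desc, ev_yon, ev_yon]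

end Tensor
end LinRep
end API

/-- A preadditive category has doubles if each object `V` has an object `U` behaving like `V ⊕ V`,
i.e. containing two orthogonal copies of `V` as retracts. -/
class HasDoubles (C : Type v) [Category.{u} C] [Preadditive C] : Prop where
  exists_double (V : C) : ∃ (U : C) (i₁ i₂ : V ⟶ U) (p₁ p₂ : U ⟶ V),
    i₁ ≫ p₁ = 𝟙 V ∧ i₂ ≫ p₂ = 𝟙 V ∧ i₁ ≫ p₂ = 0 ∧ i₂ ≫ p₁ = 0

namespace LinRep

section Monoidal

set_option linter.unusedSectionVars false

variable {k : Type u} [CommRing k] {C : Type v} [Category.{u} C] [Preadditive C] [Linear k C]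

/-- If the source category has doubles, then every natural family of maps of sets between linear
functors is linear. -/
def ofNat [HasDoubles C] {X Y : LinRep k C} (f : ∀ V, X.obj.obj V → Y.obj.obj V)
    (hf : ∀ {V W : C} (g : V ⟶ W) (x : X.obj.obj V), f W (X.act g x) = Y.act g (f V x)) : X ⟶ Y :=
  ofLinear (fun V =>
    { toFun := f V
      map_add' := fun x y => by
        obtain ⟨U, i₁, i₂, p₁, p₂, h11, h22, h12, h21⟩ := HasDoubles.exists_double V
        have h1 : X.act p₁ (X.act i₁ x + X.act i₂ y) = x := by
          rw [act_add, ← act_comp, ← act_comp, h11, h21, act_id, zero_act, add_zero]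
        have h2 : X.act p₂ (X.act i₁ x + X.act i₂ y) = y := by
          rw [act_add, ← act_comp, ← act_comp, h12, h22, act_id, zero_act, zero_add]
        have h3 : X.act (p₁ + p₂) (X.act i₁ x + X.act i₂ y) = x + y := by
          rw [add_act, h1, h2]
        rw [← h3, hf, add_act, ← hf, ← hf, h1, h2]
      map_smul' := fun r x => by
        have h : X.act (r • 𝟙 V) x = r • x := by rw [smul_act, act_id]
        rw [← h, hf, smul_act, act_id]
        rfl }) hf

theorem ap_ofNat [HasDoubles C] {X Y : LinRep k C} (f : ∀ V, X.obj.obj V → Y.obj.obj V)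
    (hf : ∀ {V W : C} (g : V ⟶ W) (x : X.obj.obj V), f W (X.act g x) = Y.act g (f V x))
    {V : C} (x : X.obj.obj V) : ap (ofNat f hf) x = f V x := rfl

variable [MonoidalCategory C] [MonoidalPreadditive C] [MonoidalLinear k C]

/-- The representation `V ↦ T(V ⊗ W)`. -/
def shiftR (T : LinRep k C) (W : C) : LinRep k C :=
  ⟨tensorRight W ⋙ T.obj, by
    have := T.property.1
    have := T.property.2
    exact ⟨inferInstance, inferInstance⟩⟩

/-- The representation `V ↦ T(W ⊗ V)`. -/
def shiftL (T : LinRep k C) (W : C) : LinRep k C :=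
  ⟨tensorLeft W ⋙ T.obj, by
    have := T.property.1
    have := T.property.2
    exact ⟨inferInstance, inferInstance⟩⟩

theorem shiftR_act (T : LinRep k C) (W : C) {V V' : C} (f : V ⟶ V') (x : T.obj.obj (V ⊗ W)) :
    (shiftR T W).act f x = T.act (f ▷ W) x := rfl

theorem shiftL_act (T : LinRep k C) (W : C) {V V' : C} (f : V ⟶ V') (x : T.obj.obj (W ⊗ V)) :
    (shiftL T W).act f x = T.act (W ◁ f) x := rfl

/-- `T(V ⊗ W) → T(V ⊗ W')`, natural in `V`. -/
def shiftRMap (T : LinRep k C) {W W' : C} (f : W ⟶ W') : shiftR T W ⟶ shiftR T W' :=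
  ofLinear (fun V => (T.obj.map (V ◁ f)).hom) fun {V V'} g x => by
    exact ((act_comp (X := T) (g ▷ W) (V' ◁ f) x).symm.trans
      (congrArg (fun h => T.act h x) (whisker_exchange g f).symm)).trans
      (act_comp (X := T) (V ◁ f) (g ▷ W') x)

/-- `T(W ⊗ V) → T(W' ⊗ V)`, natural in `V`. -/
def shiftLMap (T : LinRep k C) {W W' : C} (f : W ⟶ W') : shiftL T W ⟶ shiftL T W' :=
  ofLinear (fun V => (T.obj.map (f ▷ V)).hom) fun {V V'} g x => by
    exact ((act_comp (X := T) (W ◁ g) (f ▷ V') x).symm.trans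
      (congrArg (fun h => T.act h x) (whisker_exchange f g))).trans
      (act_comp (X := T) (f ▷ V) (W' ◁ g) x)

theorem ap_shiftRMap (T : LinRep k C) {V W W' : C} (f : W ⟶ W') (x : T.obj.obj (V ⊗ W)) :
    ap (shiftRMap T f) (V := V) x = T.act (V ◁ f) x := rfl

theorem ap_shiftLMap (T : LinRep k C) {V W W' : C} (f : W ⟶ W') (x : T.obj.obj (W ⊗ V)) :
    ap (shiftLMap T f) (V := V) x = T.act (f ▷ V) x := rfl

/-- The tensor unit, the functor represented by the unit object. -/
abbrev unit (k : Type u) [CommRing k] (C : Type v) [Category.{u} C] [Preadditive C] [Linear k C]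
    [MonoidalCategory C] : LinRep k C := (rep k C).obj (op (𝟙_ C))

/-- The element of the tensor unit given by a morphism. -/
def unitElt (k : Type u) [CommRing k] {C : Type v} [Category.{u} C] [Preadditive C] [Linear k C]
    [MonoidalCategory C] {V : C} (h : 𝟙_ C ⟶ V) : (unit k C).obj.obj V := h

/-- The morphism given by an element of the tensor unit. -/
def unitMor {V : C} (e : (unit k C).obj.obj V) : 𝟙_ C ⟶ V := e

theorem unitMor_unitElt {V : C} (h : 𝟙_ C ⟶ V) : unitMor (unitElt k h) = h := rfl

theorem unitElt_unitMor {V : C} (e : (unit k C).obj.obj V) : unitElt k (unitMor e) = e := rfl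

theorem unitMor_act {V W : C} (f : V ⟶ W) (e : (unit k C).obj.obj V) :
    unitMor ((unit k C).act f e) = unitMor e ≫ f := rfl

theorem unit_elt_eq {V : C} (e : (unit k C).obj.obj V) :
    (unit k C).act (unitMor e) (unitElt k (𝟙 (𝟙_ C))) = e := Category.id_comp (unitMor e)

variable [EssentiallySmall.{u} C] {X Y Z T : LinRep k C}

/-- Functoriality of the internal tensor product. -/
def tensorMap {X X' Y Y' : LinRep k C} (f : X ⟶ X') (g : Y ⟶ Y') : tensor X Y ⟶ tensor X' Y' :=
  desc
    { map := fun _ _ x y => tmul (ap f x) (ap g y)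
      left := fun h x y => by rw [ap_act, act_tmul_left]
      right := fun h x y => by rw [ap_act, act_tmul_right] }

theorem tensorMap_tmul {X X' Y Y' : LinRep k C} (f : X ⟶ X') (g : Y ⟶ Y') {V W : C}
    (x : X.obj.obj V) (y : Y.obj.obj W) :
    ap (tensorMap f g) (tmul x y) = tmul (ap f x) (ap g y) := by
  rw [tensorMap, desc_tmul]

/-- For fixed `z` in `Z(W)`, the map `x ⊗ y ↦ x ⊗ (y ⊗ z)`. -/
def assocHomAux (X Y : LinRep k C) {W : C} (z : Z.obj.obj W) :
    tensor X Y ⟶ shiftR (tensor X (tensor Y Z)) W :=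
  desc
    { map := fun V₁ V₂ x y => (tensor X (tensor Y Z)).act (α_ V₁ V₂ W).inv (tmul x (tmul y z))
      left := fun f x y => by
        rw [shiftR_act, ← act_tmul_left, ← act_comp, ← act_comp, associator_inv_naturality_left]
      right := fun f x y => by
        rw [shiftR_act, ← act_tmul_left, ← act_tmul_right, ← act_comp, ← act_comp,
          associator_inv_naturality_middle] }

theorem assocHomAux_tmul {V₁ V₂ W : C} (x : X.obj.obj V₁) (y : Y.obj.obj V₂) (z : Z.obj.obj W) :
    ap (assocHomAux X Y z) (tmul x y) =
      (tensor X (tensor Y Z)).act (α_ V₁ V₂ W).inv (tmul x (tmul y z)) := by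
  rw [assocHomAux, desc_tmul]

/-- The associator, `(x ⊗ y) ⊗ z ↦ x ⊗ (y ⊗ z)`. -/
def assocHom (X Y Z : LinRep k C) : tensor (tensor X Y) Z ⟶ tensor X (tensor Y Z) :=
  desc
    { map := fun _ _ s z => ap (assocHomAux X Y z) s
      left := fun f s z => ap_act _ _ _
      right := fun {V W W'} f s z => by
        have h : assocHomAux X Y (Z.act f z) =
            assocHomAux X Y z ≫ shiftRMap (tensor X (tensor Y Z)) f := by
          refine tensor_hom_ext fun V₁ V₂ x y => ?_
          rw [ap_comp, assocHomAux_tmul, assocHomAux_tmul, ap_shiftRMap, ← act_tmul_right,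
            ← act_tmul_right, ← act_comp, ← act_comp, associator_inv_naturality_right]
        rw [h]
        rfl }

theorem assocHom_tmul {V₁ V₂ W : C} (x : X.obj.obj V₁) (y : Y.obj.obj V₂) (z : Z.obj.obj W) :
    ap (assocHom X Y Z) (tmul (tmul x y) z) =
      (tensor X (tensor Y Z)).act (α_ V₁ V₂ W).inv (tmul x (tmul y z)) := by
  rw [assocHom, desc_tmul]
  exact assocHomAux_tmul x y z

/-- For fixed `x` in `X(V)`, the map `y ⊗ z ↦ (x ⊗ y) ⊗ z`. -/
def assocInvAux (Y Z : LinRep k C) {V : C} (x : X.obj.obj V) :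
    tensor Y Z ⟶ shiftL (tensor (tensor X Y) Z) V :=
  desc
    { map := fun V₁ V₂ y z => (tensor (tensor X Y) Z).act (α_ V V₁ V₂).hom (tmul (tmul x y) z)
      left := fun f x y => by
        rw [shiftL_act, ← act_tmul_right, ← act_tmul_left, ← act_comp, ← act_comp,
          associator_naturality_middle]
      right := fun f x y => by
        rw [shiftL_act, ← act_tmul_right, ← act_comp, ← act_comp, associator_naturality_right] }

theorem assocInvAux_tmul {V₁ V₂ W : C} (x : X.obj.obj V₁) (y : Y.obj.obj V₂) (z : Z.obj.obj W) :
    ap (assocInvAux Y Z x) (tmul y z) =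
      (tensor (tensor X Y) Z).act (α_ V₁ V₂ W).hom (tmul (tmul x y) z) := by
  rw [assocInvAux, desc_tmul]

/-- The inverse of the associator. -/
def assocInv (X Y Z : LinRep k C) : tensor X (tensor Y Z) ⟶ tensor (tensor X Y) Z :=
  desc
    { map := fun _ _ x s => ap (assocInvAux Y Z x) s
      left := fun {V V' W} f x s => by
        have h : assocInvAux Y Z (X.act f x) =
            assocInvAux Y Z x ≫ shiftLMap (tensor (tensor X Y) Z) f := by
          refine tensor_hom_ext fun V₁ V₂ y z => ?_
          rw [ap_comp, assocInvAux_tmul, assocInvAux_tmul, ap_shiftLMap, ← act_tmul_left,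
            ← act_tmul_left, ← act_comp, ← act_comp, associator_naturality_left]
        rw [h]
        rfl
      right := fun f s z => ap_act _ _ _ }

theorem assocInv_tmul {V₁ V₂ W : C} (x : X.obj.obj V₁) (y : Y.obj.obj V₂) (z : Z.obj.obj W) :
    ap (assocInv X Y Z) (tmul x (tmul y z)) =
      (tensor (tensor X Y) Z).act (α_ V₁ V₂ W).hom (tmul (tmul x y) z) := by
  rw [assocInv, desc_tmul]
  exact assocInvAux_tmul x y z

/-- The left unitor. -/
def leftHom (X : LinRep k C) : tensor (unit k C) X ⟶ X :=
  desc
    { map := fun V W h x => X.act ((λ_ W).inv ≫ unitMor h ▷ W) x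
      left := (fun {V V' W} f h x => by
      rw [← act_comp, Category.assoc, ← comp_whiskerRight, unitMor_act])
      right := (fun {V W W'} f h x => by
      rw [← act_comp, ← act_comp, Category.assoc, ← whisker_exchange,
        leftUnitor_inv_naturality_assoc]) }

theorem leftHom_tmul {V W : C} (h : (unit k C).obj.obj V) (x : X.obj.obj W) :
    ap (leftHom X) (tmul h x) = X.act ((λ_ W).inv ≫ unitMor h ▷ W) x := by
  rw [leftHom, desc_tmul]

/-- The right unitor. -/
def rightHom (X : LinRep k C) : tensor X (unit k C) ⟶ X :=
  desc
    { map := fun V W x h => X.act ((ρ_ V).inv ≫ V ◁ unitMor h) x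
      left := (fun {V V' W} f x h => by
      rw [← act_comp, ← act_comp, Category.assoc, whisker_exchange,
        rightUnitor_inv_naturality_assoc])
      right := (fun {V W W'} f x h => by
      rw [← act_comp, Category.assoc, ← whiskerLeft_comp, unitMor_act]) }

theorem rightHom_tmul {V W : C} (x : X.obj.obj V) (h : (unit k C).obj.obj W) :
    ap (rightHom X) (tmul x h) = X.act ((ρ_ V).inv ≫ V ◁ unitMor h) x := by
  rw [rightHom, desc_tmul]

variable [HasDoubles C]

/-- The inverse of the left unitor. -/
def leftInv (X : LinRep k C) : X ⟶ tensor (unit k C) X :=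
  ofNat (fun V x => (tensor (unit k C) X).act (λ_ V).hom (tmul (unitElt k (𝟙 (𝟙_ C))) x))
    (fun f x => by
      rw [← act_tmul_right, ← act_comp, ← act_comp, leftUnitor_naturality])

theorem leftInv_ap {V : C} (x : X.obj.obj V) : ap (leftInv X) x =
    (tensor (unit k C) X).act (λ_ V).hom (tmul (unitElt k (𝟙 (𝟙_ C))) x) := rfl

/-- The inverse of the right unitor. -/
def rightInv (X : LinRep k C) : X ⟶ tensor X (unit k C) :=
  ofNat (fun V x => (tensor X (unit k C)).act (ρ_ V).hom (tmul x (unitElt k (𝟙 (𝟙_ C)))))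
    (fun f x => by
      rw [← act_tmul_left, ← act_comp, ← act_comp, rightUnitor_naturality])

theorem rightInv_ap {V : C} (x : X.obj.obj V) : ap (rightInv X) x =
    (tensor X (unit k C)).act (ρ_ V).hom (tmul x (unitElt k (𝟙 (𝟙_ C)))) := rfl

/-- `s ↦ s ⊗ z`, as a morphism of representations. -/
def tmulRight (X : LinRep k C) {W : C} (z : Z.obj.obj W) : X ⟶ shiftR (tensor X Z) W :=
  ofNat (fun _ s => tmul s z) (fun f s => (act_tmul_left f s z).symm)

/-- `s ↦ x ⊗ s`, as a morphism of representations. -/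
def tmulLeft (Z : LinRep k C) {V : C} (x : X.obj.obj V) : Z ⟶ shiftL (tensor X Z) V :=
  ofNat (fun _ s => tmul x s) (fun f s => (act_tmul_right f x s).symm)

/-- A morphism `φ` induces `S(V ⊗ W) → T(V ⊗ W)`, natural in `V`. -/
def shiftRHom {S T : LinRep k C} (φ : S ⟶ T) (W : C) : shiftR S W ⟶ shiftR T W :=
  ofLinear (fun V => (φ.hom.app (V ⊗ W)).hom) fun _ x => ap_act φ _ x

/-- A morphism `φ` induces `S(W ⊗ V) → T(W ⊗ V)`, natural in `V`. -/
def shiftLHom {S T : LinRep k C} (φ : S ⟶ T) (W : C) : shiftL S W ⟶ shiftL T W :=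
  ofLinear (fun V => (φ.hom.app (W ⊗ V)).hom) fun _ x => ap_act φ _ x

theorem ext_left {φ ψ : tensor (tensor X Y) Z ⟶ T}
    (h : ∀ (U V W : C) (x : X.obj.obj U) (y : Y.obj.obj V) (z : Z.obj.obj W),
      ap φ (tmul (tmul x y) z) = ap ψ (tmul (tmul x y) z)) : φ = ψ :=
  tensor_hom_ext fun V W s z => by
    have : tmulRight (tensor X Y) z ≫ shiftRHom φ W = tmulRight (tensor X Y) z ≫ shiftRHom ψ W :=
      tensor_hom_ext fun V₁ V₂ x y => h _ _ _ x y z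
    exact congrArg (fun t => ap t s) this

theorem ext_right {φ ψ : tensor X (tensor Y Z) ⟶ T}
    (h : ∀ (U V W : C) (x : X.obj.obj U) (y : Y.obj.obj V) (z : Z.obj.obj W),
      ap φ (tmul x (tmul y z)) = ap ψ (tmul x (tmul y z))) : φ = ψ :=
  tensor_hom_ext fun V W x s => by
    have : tmulLeft (tensor Y Z) x ≫ shiftLHom φ V = tmulLeft (tensor Y Z) x ≫ shiftLHom ψ V :=
      tensor_hom_ext fun V₁ V₂ y z => h _ _ _ x y z
    exact congrArg (fun t => ap t s) this

theorem ext_four {S : LinRep k C} {φ ψ : tensor (tensor (tensor X Y) Z) S ⟶ T}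
    (h : ∀ (U V W A : C) (x : X.obj.obj U) (y : Y.obj.obj V) (z : Z.obj.obj W) (s : S.obj.obj A),
      ap φ (tmul (tmul (tmul x y) z) s) = ap ψ (tmul (tmul (tmul x y) z) s)) : φ = ψ :=
  tensor_hom_ext fun V W t s => by
    have : tmulRight (tensor (tensor X Y) Z) s ≫ shiftRHom φ W =
        tmulRight (tensor (tensor X Y) Z) s ≫ shiftRHom ψ W :=
      ext_left fun _ _ _ x y z => h _ _ _ _ x y z s
    exact congrArg (fun r => ap r t) this

/-- The internal tensor product on `k`-linear representations. -/
instance (priority := 10) : MonoidalCategoryStruct (LinRep k C) where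
  tensorObj := tensor
  tensorHom := tensorMap
  whiskerLeft X _ _ g := tensorMap (𝟙 X) g
  whiskerRight f Y := tensorMap f (𝟙 Y)
  tensorUnit := unit k C
  associator X Y Z :=
    { hom := assocHom X Y Z
      inv := assocInv X Y Z
      hom_inv_id := ext_left fun U V W x y z => by
        rw [ap_comp, assocHom_tmul, ap_act, assocInv_tmul, ← act_comp, Iso.hom_inv_id, act_id,
          ap_id]
      inv_hom_id := ext_right fun U V W x y z => by
        rw [ap_comp, assocInv_tmul, ap_act, assocHom_tmul, ← act_comp, Iso.inv_hom_id, act_id,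
          ap_id] }
  leftUnitor X :=
    { hom := leftHom X
      inv := leftInv X
      hom_inv_id := tensor_hom_ext fun V W h x => by
        rw [ap_comp, leftHom_tmul, leftInv_ap, ← act_tmul_right, ← act_comp, ap_id]
        conv_rhs => rw [← unit_elt_eq h, ← act_tmul_left]
        congr 1
        simp
      inv_hom_id := hom_ext fun V x => by
        rw [ap_comp, leftInv_ap, ap_act, leftHom_tmul, ← act_comp, unitMor_unitElt]
        simp [act_id, ap_id] }
  rightUnitor X :=
    { hom := rightHom X
      inv := rightInv X
      hom_inv_id := tensor_hom_ext fun V W x h => by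
        rw [ap_comp, rightHom_tmul, rightInv_ap, ← act_tmul_left, ← act_comp, ap_id]
        conv_rhs => rw [← unit_elt_eq h, ← act_tmul_right]
        congr 1
        simp
      inv_hom_id := hom_ext fun V x => by
        rw [ap_comp, rightInv_ap, ap_act, rightHom_tmul, ← act_comp, unitMor_unitElt]
        simp [act_id, ap_id] }

instance : MonoidalCategory (LinRep k C) :=
  MonoidalCategory.ofTensorHom
    (id_tensorHom_id := fun X Y => tensor_hom_ext fun V W x y => tensorMap_tmul _ _ x y)
    (id_tensorHom := fun _ _ _ _ => rfl)
    (tensorHom_id := fun _ _ => rfl)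
    (tensorHom_comp_tensorHom := fun f₁ f₂ g₁ g₂ => tensor_hom_ext fun V W x y => by
      show ap (tensorMap f₁ f₂ ≫ tensorMap g₁ g₂) _ = ap (tensorMap _ _) _
      rw [ap_comp, tensorMap_tmul, tensorMap_tmul, tensorMap_tmul, ap_comp, ap_comp])
    (associator_naturality := fun f₁ f₂ f₃ => ext_left fun U V W x y z => by
      show ap (tensorMap (tensorMap f₁ f₂) f₃ ≫ assocHom _ _ _) _ =
        ap (assocHom _ _ _ ≫ tensorMap f₁ (tensorMap f₂ f₃)) _
      rw [ap_comp, ap_comp, tensorMap_tmul, tensorMap_tmul, assocHom_tmul, assocHom_tmul, ap_act,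
        tensorMap_tmul, tensorMap_tmul])
    (leftUnitor_naturality := fun {X Y} f => tensor_hom_ext fun V W h x => by
      show ap (tensorMap (𝟙 (unit k C)) f ≫ leftHom Y) (tmul h x) =
        ap (leftHom X ≫ f) (tmul h x)
      rw [ap_comp, ap_comp, tensorMap_tmul, leftHom_tmul, leftHom_tmul, ap_act]
      rfl)
    (rightUnitor_naturality := fun {X Y} f => tensor_hom_ext fun V W x h => by
      show ap (tensorMap f (𝟙 (unit k C)) ≫ rightHom Y) (tmul x h) =
        ap (rightHom X ≫ f) (tmul x h)
      rw [ap_comp, ap_comp, tensorMap_tmul, rightHom_tmul, rightHom_tmul, ap_act]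
      rfl)
    (pentagon := fun X Y Z S => ext_four fun U V W A x y z s => by
      show ap (tensorMap (assocHom X Y Z) (𝟙 S) ≫ assocHom X (tensor Y Z) S ≫
          tensorMap (𝟙 X) (assocHom Y Z S)) _ =
        ap (assocHom (tensor X Y) Z S ≫ assocHom X Y (tensor Z S)) _
      rw [ap_comp, ap_comp, ap_comp, tensorMap_tmul, assocHom_tmul, assocHom_tmul, ap_act,
        assocHom_tmul, ap_id, ← act_tmul_left, ap_act, ap_act, assocHom_tmul, ap_act,
        tensorMap_tmul, assocHom_tmul, ap_id, ← act_tmul_right, ← act_comp, ← act_comp,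
        ← act_comp]
      congr 1
      simp)
    (triangle := fun X Y => ext_left fun U V W x h y => by
      show ap (assocHom X (unit k C) Y ≫ tensorMap (𝟙 X) (leftHom Y))
          (tmul (tmul x h) y) =
        ap (tensorMap (rightHom X) (𝟙 Y)) (tmul (tmul x h) y)
      rw [ap_comp, assocHom_tmul, ap_act, tensorMap_tmul, tensorMap_tmul, leftHom_tmul,
        rightHom_tmul, ap_id, ap_id, ← act_tmul_left, ← act_tmul_right, ← act_comp]
      congr 1
      simp)

end Monoidal
end LinRep

instance {k : Type u} [CommRing k] {d : ℕ} {D : Type v} [Category.{u} D] [Preadditive D]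
    [Linear k D] [EssentiallySmall.{u} D] : EssentiallySmall.{u} (GammaCat k d D) := by
  have : Small.{u} (Skeleton (GammaCat k d D)) := by
    refine small_of_surjective (α := Skeleton D)
      (f := fun V => toSkeleton ((GammaCat.γ k d D).obj ((fromSkeleton D).obj V))) fun W => ?_
    refine ⟨toSkeleton ((fromSkeleton _).obj W).as, ?_⟩
    rw [← toSkeleton_fromSkeleton_obj W, toSkeleton_eq_iff]
    exact ⟨(GammaCat.γ k d D).mapIso (fromSkeletonToSkeletonIso _)⟩
  exact (essentiallySmall_iff _).2 ⟨this, inferInstance⟩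

instance {k : Type u} [CommRing k] {d : ℕ} [NeZero d] {D : Type v} [Category.{u} D]
    [Preadditive D] [Linear k D] [HasDoubles D] : HasDoubles (GammaCat k d D) where
  exists_double V := by
    obtain ⟨U, i₁, i₂, p₁, p₂, h11, h22, h12, h21⟩ := HasDoubles.exists_double V.as
    have hz : ∀ {A B : D}, (GammaCat.γ k d D).map (0 : A ⟶ B) = 0 := fun {A B} =>
      Subtype.ext <| MultilinearMap.map_coord_zero (PiTensorProduct.tprod k)
        (⟨0, Nat.pos_of_ne_zero (NeZero.ne d)⟩ : Fin d) rfl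
    refine ⟨⟨U⟩, (GammaCat.γ k d D).map i₁, (GammaCat.γ k d D).map i₂, (GammaCat.γ k d D).map p₁,
      (GammaCat.γ k d D).map p₂, ?_, ?_, ?_, ?_⟩
    · exact ((GammaCat.γ k d D).map_comp i₁ p₁).symm.trans
        ((congrArg _ h11).trans ((GammaCat.γ k d D).map_id _))
    · exact ((GammaCat.γ k d D).map_comp i₂ p₂).symm.trans
        ((congrArg _ h22).trans ((GammaCat.γ k d D).map_id _))
    · exact ((GammaCat.γ k d D).map_comp i₁ p₂).symm.trans ((congrArg _ h12).trans hz)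
    · exact ((GammaCat.γ k d D).map_comp i₂ p₁).symm.trans ((congrArg _ h21).trans hz)

section FGProj

variable (k : Type u) [CommRing k]

/-- The property of a `k`-module of being finitely generated projective. -/
def isFGProj : ObjectProperty (ModuleCat.{u} k) :=
  fun V => Module.Finite k V ∧ Module.Projective k V

/-- The category `P_k` of finitely generated projective `k`-modules. -/
abbrev FGProj := (isFGProj k).FullSubcategory

instance : (isFGProj k).IsMonoidal where
  prop_unit := ⟨Module.Finite.self k, inferInstanceAs (Module.Projective k k)⟩
  prop_tensor X Y hX hY := by
    have := hX.1; have := hX.2; have := hY.1; have := hY.2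
    exact ⟨inferInstanceAs (Module.Finite k (X ⊗[k] Y)),
      inferInstanceAs (Module.Projective k (X ⊗[k] Y))⟩

theorem isFGProj_le : isFGProj k ≤ ModuleCat.isFG k := fun _ h => h.1

instance : EssentiallySmall.{u} (FGProj k) :=
  have : EssentiallySmall.{u} (ModuleCat.isFG k).FullSubcategory :=
    inferInstanceAs (EssentiallySmall.{u} (FGModuleCat.{u} k))
  essentiallySmall_of_fully_faithful (ObjectProperty.ιOfLE (isFGProj_le k))

instance : HasDoubles (FGProj k) where
  exists_double V := by
    have := V.property.1
    have := V.property.2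
    let U : FGProj k := ⟨ModuleCat.of k (V.obj × V.obj),
      inferInstanceAs (Module.Finite k (V.obj × V.obj)),
      inferInstanceAs (Module.Projective k (V.obj × V.obj))⟩
    let i₁ : V ⟶ U := ObjectProperty.homMk (ModuleCat.ofHom (LinearMap.inl k V.obj V.obj))
    let i₂ : V ⟶ U := ObjectProperty.homMk (ModuleCat.ofHom (LinearMap.inr k V.obj V.obj))
    let p₁ : U ⟶ V := ObjectProperty.homMk (ModuleCat.ofHom (LinearMap.fst k V.obj V.obj))
    let p₂ : U ⟶ V := ObjectProperty.homMk (ModuleCat.ofHom (LinearMap.snd k V.obj V.obj))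
    exact ⟨U, i₁, i₂, p₁, p₂, rfl, rfl, rfl, rfl⟩

variable (d : ℕ)

/-- The category `Γ^d P_k` of degree `d` divided powers. -/
abbrev DivPow := GammaCat k d (FGProj k)

/-- The category `Rep Γ^d_k` of strict polynomial functors of degree `d` over `k`. -/
abbrev StrictPolyFunctor := LinRep k (DivPow k d)

variable {k}

/-- The bilinear evaluation map `Hom(V, W) × V → W`. -/
def evalBilin (V W : FGProj k) : (V ⟶ W) →ₗ[k] V.obj →ₗ[k] W.obj where
  toFun f := f.hom.hom
  map_add' _ _ := rfl
  map_smul' _ _ := rfl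

theorem evalBilin_apply {V W : FGProj k} (f : V ⟶ W) (v : V.obj) :
    evalBilin V W f v = f.hom.hom v := rfl

variable (k)

/-- The strict polynomial functor `Γ^ω` for `ω = (1, …, 1)`, i.e. `Γ¹ ⊗ ⋯ ⊗ Γ¹` (`d` factors,
external tensor product): on objects `V ↦ V^{⊗d}`, while
`f ∈ Γ^d Hom(V, W) ⊆ Hom(V, W)^{⊗d}` acts by factorwise evaluation. -/
def Gω : StrictPolyFunctor k d where
  obj :=
    { obj := fun V => ModuleCat.of k (⨂[k] _ : Fin d, V.as.obj)
      map := fun {V W} f => ModuleCat.ofHom (powMap₂ d (evalBilin V.as W.as) f.1)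
      map_id := fun V => by
        refine ModuleCat.hom_ext (LinearMap.ext fun x => ?_)
        show powMap₂ d (evalBilin V.as V.as) (𝟙 V : V ⟶ V).1 x = x
        rw [GammaCat.id_val]
        induction x using PiTensorProduct.induction_on with
        | add x₁ x₂ h₁ h₂ => rw [map_add, h₁, h₂]
        | smul_tprod r a =>
          rw [map_smul, powMap₂_tprod]
          rfl
      map_comp := fun {U V W} f g => by
        refine ModuleCat.hom_ext (LinearMap.ext fun x => ?_)
        show powMap₂ d (evalBilin U.as W.as) (f ≫ g).1 x = powMap₂ d (evalBilin V.as W.as) g.1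
          (powMap₂ d (evalBilin U.as V.as) f.1 x)
        rw [GammaCat.comp_val]
        generalize f.1 = y
        generalize g.1 = z
        induction x using PiTensorProduct.induction_on with
        | add x₁ x₂ h₁ h₂ => simp only [map_add, h₁, h₂]
        | smul_tprod r a =>
        induction y using PiTensorProduct.induction_on with
        | add x₁ x₂ h₁ h₂ => simp only [map_add, LinearMap.add_apply, h₁, h₂]
        | smul_tprod s b =>
        induction z using PiTensorProduct.induction_on with
        | add x₁ x₂ h₁ h₂ => simp only [map_add, LinearMap.add_apply, h₁, h₂]
        | smul_tprod t c =>
          simp only [map_smul, LinearMap.smul_apply, powMap₂_tprod, GammaCat.compBilin_apply,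
            evalBilin_apply]
          rw [smul_comm s t]
          rfl }
  property :=
    ⟨⟨fun {V W} {f g} => by
      refine ModuleCat.hom_ext (LinearMap.ext fun x => ?_)
      exact congrArg (fun l => l x) (map_add (powMap₂ d (evalBilin V.as W.as)) f.1 g.1)⟩,
     ⟨fun {V W} f r => by
      refine ModuleCat.hom_ext (LinearMap.ext fun x => ?_)
      exact congrArg (fun l => l x) (map_smul (powMap₂ d (evalBilin V.as W.as)) r f.1)⟩⟩

/-- The endomorphism of `Γ^ω` given by the right place permutation action of `σ`,
`v₁ ⊗ ⋯ ⊗ v_d ↦ v_{σ(1)} ⊗ ⋯ ⊗ v_{σ(d)}`. -/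
def permGω (σ : Equiv.Perm (Fin d)) : Gω k d ⟶ Gω k d :=
  ObjectProperty.homMk
    { app := fun V => ModuleCat.ofHom (permute k d V.as.obj σ)
      naturality := fun V W f => by
        refine ModuleCat.hom_ext (LinearMap.ext fun x => ?_)
        exact (permute_powMap₂ d (evalBilin V.as W.as) σ f.1 x).trans
          (congrArg (fun y => powMap₂ d (evalBilin V.as W.as) y (permute k d V.as.obj σ x))
            (f.2 σ)) }

theorem permute_one (M : Type u) [AddCommGroup M] [Module k M] (x : ⨂[k] _ : Fin d, M) :
    permute k d M 1 x = x := by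
  induction x using PiTensorProduct.induction_on with
  | add x₁ x₂ h₁ h₂ => rw [map_add, h₁, h₂]
  | smul_tprod r a => rw [map_smul, permute_tprod]; rfl

theorem permute_mul (M : Type u) [AddCommGroup M] [Module k M] (σ τ : Equiv.Perm (Fin d))
    (x : ⨂[k] _ : Fin d, M) :
    permute k d M (σ * τ) x = permute k d M τ (permute k d M σ x) := by
  induction x using PiTensorProduct.induction_on with
  | add x₁ x₂ h₁ h₂ => simp only [map_add, h₁, h₂]
  | smul_tprod r a => simp only [map_smul, permute_tprod]; rfl

theorem permGω_one : permGω k d 1 = 𝟙 (Gω k d) :=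
  LinRep.hom_ext fun V x => permute_one k d V.as.obj x

theorem permGω_mul (σ τ : Equiv.Perm (Fin d)) :
    permGω k d (σ * τ) = permGω k d σ ≫ permGω k d τ :=
  LinRep.hom_ext fun V x => permute_mul k d V.as.obj σ τ x

end FGProj

section Schur

variable (k : Type u) [CommRing k] (d : ℕ)

/-- The left action of the symmetric group on `Hom(Γ^ω, X)`, induced by the right place permutation
action on `Γ^ω`. -/
def homAction (X : StrictPolyFunctor k d) :
    Representation k (Equiv.Perm (Fin d)) (Gω k d ⟶ X) where
  toFun σ := Linear.leftComp k X (permGω k d σ)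
  map_one' := LinearMap.ext fun f => by
    show permGω k d 1 ≫ f = f
    rw [permGω_one, Category.id_comp]
  map_mul' σ τ := LinearMap.ext fun f => by
    show permGω k d (σ * τ) ≫ f = permGω k d σ ≫ permGω k d τ ≫ f
    rw [permGω_mul, Category.assoc]

/-- The representation `Hom(Γ^ω, X)` of the symmetric group, on a copy of the module of natural
transformations in the universe of `k`. -/
def schurRep (X : StrictPolyFunctor k d) :
    Representation k (Equiv.Perm (Fin d)) (Shrink.{u} (Gω k d ⟶ X)) :=
  ((Shrink.linearEquiv k (Gω k d ⟶ X)).symm.conjAlgEquiv k :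
    Module.End k (Gω k d ⟶ X) →* Module.End k (Shrink.{u} (Gω k d ⟶ X))).comp (homAction k d X)

/-- The functor `F = Hom(Γ^ω, -)` from strict polynomial functors of degree `d` to left modules over
the group algebra of the symmetric group on `d` letters. -/
def schurFunctor : StrictPolyFunctor k d ⥤ Rep.{u} k (Equiv.Perm (Fin d)) where
  obj X := Rep.of (schurRep k d X)
  map {X Y} φ := Rep.ofHom
    { toLinearMap := (Shrink.linearEquiv k (Gω k d ⟶ Y)).symm.toLinearMap ∘ₗ
        Linear.rightComp k (Gω k d) φ ∘ₗ (Shrink.linearEquiv k (Gω k d ⟶ X)).toLinearMap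
      isIntertwining' := fun σ => LinearMap.ext fun x => by
        simp [schurRep, homAction] }
  map_id X := by
    ext x
    simp
  map_comp φ ψ := by
    ext x
    simp

end Schur

end SPF

end

/-!
Let `E = k^d` in `Γ^d P_k`. Composing a morphism `Γ^ω ⟶ X` with evaluation at
`b₁ ⊗ ⋯ ⊗ b_d ∈ Γ^ω(E) = E^{⊗d}` identifies `Hom(Γ^ω, X)` with the weight space
`wt X = {x ∈ X(E) | e x = x}` of weight `(1, …, 1)`; here `e` is the idempotent endomorphism of `E`
obtained by symmetrizing `e₁₁ ⊗ ⋯ ⊗ e_dd` (`homEquivWt`). The symmetric group acts on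
`wt X` through the permutation matrices (`homEquivWt_homAction`), so it is enough to show that
`X ↦ wt X` is strong monoidal.

The ring `k^d` makes `E` a monoid object of `Γ^d P_k`, and both `e` and the permutation matrices are
compatible with its multiplication. Hence `x ⊗ y ↦ mul · (x ⊗ y)` is a lax monoidal structure on
`wt`, whose coherence is that of the monoid `E` (`WeightAlgebra.coreMonoidal`). To see that it is
invertible, consider `P(V) = {f : V ⟶ E | e f = f}`, the weight space of the functor represented by
`V`. It suffices that `P` is strong monoidal, i.e. that `f ⊗ g ↦ mul ∘ (f ⊗ g)` is bijective from
`P(V) ⊗ P(W)` to `P(V ⊗ W)`, and that `P(𝟙) = k` (`WeightAlgebra.IsStrong`). Surjectivity for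
general `X` and `Y` then holds because `X ⊗ Y` is spanned by the translates of the elements `x ⊗ y`
(`LinRep.tensor_span`). For injectivity, the inverse bijections for `P` assemble to a natural
transformation from `X ⊗ Y` to `V ↦ Hom_k(P(V), wt X ⊗ wt Y)`, whose value at `e ∈ P(E)` is a
retraction (`WeightAlgebra.mu_injective`).

Finally `P(V) ≅ (V^*)^{⊗d}`: the symmetrizations of `φ₁ ⊗ ⋯ ⊗ φ_d`, with `φᵢ` regarded as a map to the
`i`-th summand of `E`, span `P(V)`, and a dual basis of `V` gives one of `P(V)`
(`UnitPower.homWt_eq_sum`). Since dual bases are multiplicative for the tensor product, `P` is strong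
monoidal (`UnitPower.isStrong`).
-/

noncomputable section

namespace SPF

/-! ### Linear representations and the internal tensor product -/

/-- A monoid object `E` of a monoidal category together with an idempotent endomorphism `e` and an
action of a group `G` on `E`, both multiplicative; the action fixes the unit and commutes with `e`.
The idempotent need not preserve the unit. -/
structure WeightAlgebra (C : Type v) [Category.{u} C] [MonoidalCategory C] (G : Type*)
    [Group G] where
  /-- the underlying object -/
  E : C
  /-- the multiplication -/
  mul : E ⊗ E ⟶ E
  /-- the unit -/
  one : 𝟙_ C ⟶ E
  /-- the idempotent -/
  e : E ⟶ E
  /-- the group action -/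
  s : G → (E ⟶ E)
  mul_assoc : (mul ▷ E) ≫ mul = (α_ E E E).hom ≫ (E ◁ mul) ≫ mul
  one_mul : (one ▷ E) ≫ mul = (λ_ E).hom
  mul_one : (E ◁ one) ≫ mul = (ρ_ E).hom
  e_e : e ≫ e = e
  mul_e : mul ≫ e = (e ⊗ₘ e) ≫ mul
  s_one : s 1 = 𝟙 E
  s_mul (σ τ : G) : s (σ * τ) = s τ ≫ s σ
  s_e (σ : G) : s σ ≫ e = e ≫ s σ
  mul_s (σ : G) : mul ≫ s σ = (s σ ⊗ₘ s σ) ≫ mul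
  one_s (σ : G) : one ≫ s σ = one

namespace LinRep

variable {k : Type u} [CommRing k] {C : Type v} [Category.{u} C] [Preadditive C] [Linear k C]
  {X Y Z : LinRep k C} {V W : C}

/-- For a `k`-module `M` and a linear presheaf of the form `V ↦ P(V)` given by a submodule of
`Hom(V, E)` stable under precomposition, the representation `V ↦ Hom_k(P(V), M)`. -/
def coind (E : C) (P : ∀ V : C, Submodule k (V ⟶ E))
    (hP : ∀ {V W : C} (f : V ⟶ W) {g : W ⟶ E}, g ∈ P W → f ≫ g ∈ P V)
    (M : Type u) [AddCommGroup M] [Module k M] : LinRep k C where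
  obj :=
    { obj := fun V => ModuleCat.of k (P V →ₗ[k] M)
      map := fun {V W} f => ModuleCat.ofHom
        ((((Linear.leftComp k E f).restrict (p := P W) (q := P V)
          fun _ hg => hP f hg)).lcomp k M)
      map_id := fun V => by
        ext q x
        exact congrArg q (Subtype.ext (Category.id_comp x.1))
      map_comp := fun f g => by
        ext q x
        exact congrArg q (Subtype.ext (Category.assoc f g x.1)) }
  property :=
    ⟨⟨fun {V W} {f g} => by
      ext q x
      exact (congrArg q (Subtype.ext (Preadditive.add_comp _ _ _ f g x.1) :
        _ = (⟨f ≫ x.1, hP f x.2⟩ + ⟨g ≫ x.1, hP g x.2⟩ : P V))).trans (map_add q _ _)⟩,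
     ⟨fun {V W} f r => by
      ext q x
      exact (congrArg q (Subtype.ext (Linear.smul_comp _ _ _ r f x.1) :
        _ = (r • ⟨f ≫ x.1, hP f x.2⟩ : P V))).trans (map_smul q _ _)⟩⟩

section TensorLinear

variable [EssentiallySmall.{u} C] [MonoidalCategory C]

theorem act_tmul {V' W' : C} (f : V ⟶ V') (g : W ⟶ W') (x : X.obj.obj V) (y : Y.obj.obj W) :
    (tensor X Y).act (f ⊗ₘ g) (tmul x y) = tmul (X.act f x) (Y.act g y) := by
  rw [MonoidalCategory.tensorHom_def, act_comp, act_tmul_left, act_tmul_right]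

/-- The values of the internal tensor product are spanned by the images of the canonical
elements `x ⊗ y`. -/
theorem tensor_span (U : C) (S : Submodule k ((tensor X Y).obj.obj U))
    (hS : ∀ (V W : C) (f : V ⊗ W ⟶ U) (x : X.obj.obj V) (y : Y.obj.obj W),
      (tensor X Y).act f (tmul x y) ∈ S) : S = ⊤ := by
  -- `N` is the largest subrepresentation with `N U ≤ S`; it contains all the canonical elements,
  -- so the projection to the quotient by `N` is zero
  let N : ∀ A : C, Submodule k ((tensor X Y).obj.obj A) := fun A =>
    ⨅ f : A ⟶ U, S.comap ((tensor X Y).obj.map f).hom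
  have memN : ∀ {A : C} {t : (tensor X Y).obj.obj A},
      t ∈ N A ↔ ∀ f : A ⟶ U, (tensor X Y).act f t ∈ S := fun {A t} => by
    simp only [N, Submodule.mem_iInf, Submodule.mem_comap]
    rfl
  have hN : ∀ {A B : C} (g : A ⟶ B), N A ≤ (N B).comap ((tensor X Y).obj.map g).hom := by
    intro A B g t ht
    refine memN.2 fun f => ?_
    show (tensor X Y).act f ((tensor X Y).act g t) ∈ S
    rw [← act_comp]
    exact memN.1 ht _
  let Q : LinRep k C :=
    { obj :=
        { obj := fun A => ModuleCat.of k ((tensor X Y).obj.obj A ⧸ N A)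
          map := fun {A B} g => ModuleCat.ofHom ((N A).mapQ (N B) _ (hN g))
          map_id := fun A => by
            refine ModuleCat.hom_ext (Submodule.linearMap_qext _ (LinearMap.ext fun t => ?_))
            exact congrArg (N A).mkQ (act_id t)
          map_comp := fun {A B D} f g => by
            refine ModuleCat.hom_ext (Submodule.linearMap_qext _ (LinearMap.ext fun t => ?_))
            exact congrArg (N D).mkQ (act_comp f g t) }
      property :=
        ⟨⟨fun {A B} {f g} => by
          refine ModuleCat.hom_ext (Submodule.linearMap_qext _ (LinearMap.ext fun t => ?_))
          exact congrArg (N B).mkQ (add_act f g t)⟩,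
         ⟨fun {A B} f r => by
          refine ModuleCat.hom_ext (Submodule.linearMap_qext _ (LinearMap.ext fun t => ?_))
          exact congrArg (N B).mkQ (smul_act r f t)⟩⟩ }
  let π : tensor X Y ⟶ Q := ofLinear (fun A => (N A).mkQ) fun _ _ => rfl
  let z : tensor X Y ⟶ Q := ofLinear (fun A => 0) fun g _ => (map_zero (Q.obj.map g).hom).symm
  have h : π = z := tensor_hom_ext fun V W x y =>
    (Submodule.Quotient.mk_eq_zero (N (V ⊗ W))).2 (memN.2 fun f => hS V W f x y)
  refine eq_top_iff.2 fun t _ => ?_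
  have ht : t ∈ N U := (Submodule.Quotient.mk_eq_zero (N U)).1
    (congrArg (fun φ : tensor X Y ⟶ Q => ap φ t) h)
  have := memN.1 ht (𝟙 U)
  rwa [act_id] at this

variable [MonoidalPreadditive C] [MonoidalLinear k C] [HasDoubles C]

/-- The canonical pairing `X(V) × Y(W) → (X ⊗ Y)(V ⊗ W)` as a bilinear map. -/
def tmulBilin (X Y : LinRep k C) (V W : C) :
    X.obj.obj V →ₗ[k] Y.obj.obj W →ₗ[k] (tensor X Y).obj.obj (V ⊗ W) :=
  LinearMap.mk₂ k tmul
    (fun x x' y => ap_add (tmulRight X y) x x')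
    (fun r x y => ap_smul (tmulRight X y) r x)
    (fun x y y' => ap_add (tmulLeft Y x) y y')
    (fun r x y => ap_smul (tmulLeft Y x) r y)

theorem tmulBilin_apply (x : X.obj.obj V) (y : Y.obj.obj W) :
    tmulBilin X Y V W x y = tmul x y := rfl

end TensorLinear

end LinRep

/-! ### Weight spaces of linear representations -/

namespace WeightAlgebra

open LinRep

section

variable {C : Type v} [Category.{u} C] [MonoidalCategory C] {G : Type*} [Group G]
  (A : WeightAlgebra C G)

theorem one_e_tensor_e_mul : ((A.one ≫ A.e) ⊗ₘ A.e) ≫ A.mul = (λ_ A.E).hom ≫ A.e := by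
  rw [← A.one_mul, Category.assoc, A.mul_e, ← tensorHom_id, tensorHom_comp_tensorHom_assoc,
    Category.id_comp]

theorem e_tensor_one_e_mul : (A.e ⊗ₘ (A.one ≫ A.e)) ≫ A.mul = (ρ_ A.E).hom ≫ A.e := by
  rw [← A.mul_one, Category.assoc, A.mul_e, ← id_tensorHom, tensorHom_comp_tensorHom_assoc,
    Category.id_comp]

end

variable {k : Type u} [CommRing k] {C : Type v} [Category.{u} C] [Preadditive C] [Linear k C]
  [MonoidalCategory C] {G : Type*} [Group G] (A : WeightAlgebra C G)

variable (k) in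
/-- The submodule of those morphisms `V ⟶ E` that are fixed by the idempotent. -/
def homWt (V : C) : Submodule k (V ⟶ A.E) where
  carrier := {f | f ≫ A.e = f}
  add_mem' {f g} hf hg := by
    rw [Set.mem_ofPred_eq, Preadditive.add_comp, hf, hg]
  zero_mem' := Limits.zero_comp
  smul_mem' r f hf := by
    rw [Set.mem_ofPred_eq, Linear.smul_comp, hf]

theorem mem_homWt {V : C} {f : V ⟶ A.E} : f ∈ A.homWt k V ↔ f ≫ A.e = f := Iff.rfl

theorem comp_mem_homWt {V W : C} (f : V ⟶ W) {g : W ⟶ A.E} (hg : g ∈ A.homWt k W) :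
    f ≫ g ∈ A.homWt k V := by
  rw [mem_homWt, Category.assoc, A.mem_homWt.1 hg]

variable (k) in
/-- Precomposition with a morphism. -/
def homWtPre {V W : C} (f : V ⟶ W) : A.homWt k W →ₗ[k] A.homWt k V :=
  (Linear.leftComp k A.E f).restrict fun _ hg => A.comp_mem_homWt f hg

theorem homWtPre_val {V W : C} (f : V ⟶ W) (g : A.homWt k W) :
    (A.homWtPre k f g).1 = f ≫ g.1 := rfl

/-- The weight space of a representation: the elements of `X(E)` fixed by the idempotent. -/
def wt (X : LinRep k C) : Submodule k (X.obj.obj A.E) where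
  carrier := {x | X.act A.e x = x}
  add_mem' {x y} hx hy := by
    rw [Set.mem_ofPred_eq, act_add, hx, hy]
  zero_mem' := map_zero _
  smul_mem' r x hx := by
    rw [Set.mem_ofPred_eq, act_smul, hx]

variable {X Y Z : LinRep k C} {V W : C}

theorem mem_wt {x : X.obj.obj A.E} : x ∈ A.wt X ↔ X.act A.e x = x := Iff.rfl

/-- The action of the group on the weight space. -/
def wtRep (X : LinRep k C) : Representation k G (A.wt X) where
  toFun σ := (X.obj.map (A.s σ)).hom.restrict (p := A.wt X) (q := A.wt X) fun x hx => by
    show X.act A.e (X.act (A.s σ) x) = X.act (A.s σ) x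
    rw [← act_comp, A.s_e, act_comp, A.mem_wt.1 hx]
  map_one' := LinearMap.ext fun x => Subtype.ext <| by
    show X.act (A.s 1) x.1 = x.1
    rw [A.s_one, act_id]
  map_mul' σ τ := LinearMap.ext fun x => Subtype.ext <| by
    show X.act (A.s (σ * τ)) x.1 = X.act (A.s σ) (X.act (A.s τ) x.1)
    rw [A.s_mul, act_comp]

theorem wtRep_val (σ : G) (x : A.wt X) : (A.wtRep X σ x).1 = X.act (A.s σ) x.1 := rfl

/-- The map induced on weight spaces by a morphism of representations. -/
def wtMap (φ : X ⟶ Y) : A.wt X →ₗ[k] A.wt Y :=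
  (φ.hom.app A.E).hom.restrict (p := A.wt X) (q := A.wt Y) fun x hx => by
    show Y.act A.e (ap φ x) = ap φ x
    rw [← ap_act, A.mem_wt.1 hx]

variable (k) in
/-- The weight space functor. -/
def wtFunctor : LinRep k C ⥤ Rep.{u} k G where
  obj X := Rep.of (A.wtRep X)
  map φ := Rep.ofHom
    { toLinearMap := A.wtMap φ
      isIntertwining' := fun σ => LinearMap.ext fun x => Subtype.ext (ap_act φ (A.s σ) x.1) }

/-- For `x` in `X(V)` and `g : V ⟶ E` fixed by the idempotent, the image of `x` under `g` lies in
the weight space. -/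
def actBilin (X : LinRep k C) (V : C) : X.obj.obj V →ₗ[k] A.homWt k V →ₗ[k] A.wt X :=
  LinearMap.mk₂ k
    (fun x g => ⟨X.act g.1 x, by rw [mem_wt, ← act_comp, A.mem_homWt.1 g.2]⟩)
    (fun x x' g => Subtype.ext (act_add _ x x'))
    (fun r x g => Subtype.ext (act_smul _ r x))
    (fun x g g' => Subtype.ext (add_act g.1 g'.1 x))
    (fun r x g => Subtype.ext (smul_act r g.1 x))

theorem actBilin_val (x : X.obj.obj V) (g : A.homWt k V) :
    (A.actBilin X V x g).1 = X.act g.1 x := rfl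

theorem actBilin_act {V' : C} (f : V ⟶ V') (x : X.obj.obj V) :
    A.actBilin X V' (X.act f x) = A.actBilin X V x ∘ₗ A.homWtPre k f :=
  LinearMap.ext fun g => Subtype.ext (act_comp f g.1 x).symm

/-- The representation `V ↦ Hom_k(homWt V, M)`. -/
def coindWt (M : Type u) [AddCommGroup M] [Module k M] : LinRep k C :=
  coind A.E (A.homWt k) (fun f _ hg => A.comp_mem_homWt f hg) M

theorem coindWt_act {M : Type u} [AddCommGroup M] [Module k M] (f : V ⟶ W)
    (q : A.homWt k V →ₗ[k] M) (g : A.homWt k W) :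
    (show A.homWt k W →ₗ[k] M from (A.coindWt M).act f q) g = q (A.homWtPre k f g) := rfl

section Bilinear

variable [MonoidalPreadditive C] [MonoidalLinear k C]

variable (k) in
/-- The product `f ⊗ g ↦ mul ∘ (f ⊗ g)` of morphisms with values in `E` fixed by the
idempotent. -/
def pair (V W : C) : A.homWt k V ⊗[k] A.homWt k W →ₗ[k] A.homWt k (V ⊗ W) :=
  TensorProduct.lift (LinearMap.mk₂ k
    (fun f g => ⟨(f.1 ⊗ₘ g.1) ≫ A.mul, by
      rw [mem_homWt, Category.assoc, A.mul_e, tensorHom_comp_tensorHom_assoc,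
        A.mem_homWt.1 f.2, A.mem_homWt.1 g.2]⟩)
    (fun f f' g => Subtype.ext (by simp [MonoidalPreadditive.add_tensor]))
    (fun r f g => Subtype.ext (by simp [MonoidalCategory.tensorHom_def]))
    (fun f g g' => Subtype.ext (by simp [MonoidalPreadditive.tensor_add]))
    (fun r f g => Subtype.ext (by simp [MonoidalCategory.tensorHom_def])))

theorem pair_tmul_val (f : A.homWt k V) (g : A.homWt k W) :
    (A.pair k V W (f ⊗ₜ g)).1 = (f.1 ⊗ₘ g.1) ≫ A.mul := rfl

theorem pair_map_homWtPre {V' W' : C} (f : V ⟶ V') (g : W ⟶ W')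
    (t : A.homWt k V' ⊗[k] A.homWt k W') :
    A.pair k V W (TensorProduct.map (A.homWtPre k f) (A.homWtPre k g) t) =
      A.homWtPre k (f ⊗ₘ g) (A.pair k V' W' t) := by
  induction t with
  | zero => simp only [map_zero]
  | add t t' h h' => simp only [map_add, h, h']
  | tmul a b =>
    refine Subtype.ext ?_
    rw [TensorProduct.map_tmul, pair_tmul_val, homWtPre_val, homWtPre_val, homWtPre_val,
      pair_tmul_val, tensorHom_comp_tensorHom_assoc]

end Bilinear

variable (k) in
/-- The map `r ↦ r • (e ∘ one)`. -/
def unitMap : k →ₗ[k] A.homWt k (𝟙_ C) :=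
  LinearMap.toSpanSingleton k _ ⟨A.one ≫ A.e, by rw [mem_homWt, Category.assoc, A.e_e]⟩

variable (k) in
/-- The contravariant functor `V ↦ homWt V` is strong monoidal. -/
structure IsStrong [MonoidalPreadditive C] [MonoidalLinear k C] : Prop where
  pair_bijective (V W : C) : Function.Bijective (A.pair k V W)
  unitMap_bijective : Function.Bijective (A.unitMap k)

section Unpair

variable {A} [MonoidalPreadditive C] [MonoidalLinear k C]

/-- The linear map `homWt (V ⊗ W) → wt X ⊗ wt Y` determined by
`mul ∘ (f ⊗ g) ↦ (f · x) ⊗ (g · y)`. -/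
def unpair (hA : A.IsStrong k) (x : X.obj.obj V) (y : Y.obj.obj W) :
    A.homWt k (V ⊗ W) →ₗ[k] A.wt X ⊗[k] A.wt Y :=
  TensorProduct.map (A.actBilin X V x) (A.actBilin Y W y) ∘ₗ
    (LinearEquiv.ofBijective _ (hA.pair_bijective V W)).symm.toLinearMap

theorem unpair_pair (hA : A.IsStrong k) (x : X.obj.obj V) (y : Y.obj.obj W)
    (t : A.homWt k V ⊗[k] A.homWt k W) :
    unpair hA x y (A.pair k V W t) =
      TensorProduct.map (A.actBilin X V x) (A.actBilin Y W y) t :=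
  congrArg _ (LinearEquiv.ofBijective_symm_apply_apply (A.pair k V W) t)

theorem unpair_act (hA : A.IsStrong k) {V' W' : C} (f : V ⟶ V') (g : W ⟶ W')
    (x : X.obj.obj V) (y : Y.obj.obj W) :
    unpair hA (X.act f x) (Y.act g y) = unpair hA x y ∘ₗ A.homWtPre k (f ⊗ₘ g) := by
  refine LinearMap.ext fun q => ?_
  obtain ⟨t, rfl⟩ := (hA.pair_bijective V' W').2 q
  rw [LinearMap.comp_apply, ← pair_map_homWtPre, unpair_pair, unpair_pair, actBilin_act,
    actBilin_act, TensorProduct.map_comp, LinearMap.comp_apply]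

end Unpair

section Tensor

variable [EssentiallySmall.{u} C] [MonoidalPreadditive C] [MonoidalLinear k C] [HasDoubles C]

/-- The comparison map `x ⊗ y ↦ mul · (x ⊗ y)`. -/
def mu (X Y : LinRep k C) : A.wt X ⊗[k] A.wt Y →ₗ[k] A.wt (tensor X Y) :=
  TensorProduct.lift (LinearMap.mk₂ k
    (fun x y => ⟨(tensor X Y).act A.mul (tmul x.1 y.1), by
      rw [mem_wt, ← act_comp, A.mul_e, act_comp, act_tmul, A.mem_wt.1 x.2, A.mem_wt.1 y.2]⟩)
    (fun x x' y => Subtype.ext (by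
      simp only [← tmulBilin_apply, Submodule.coe_add, map_add, LinearMap.add_apply, act_add]))
    (fun r x y => Subtype.ext (by
      simp only [← tmulBilin_apply, Submodule.coe_smul, map_smul, LinearMap.smul_apply, act_smul]))
    (fun x y y' => Subtype.ext (by
      simp only [← tmulBilin_apply, Submodule.coe_add, map_add, act_add]))
    (fun r x y => Subtype.ext (by
      simp only [← tmulBilin_apply, Submodule.coe_smul, map_smul, act_smul])))

theorem mu_tmul_val (x : A.wt X) (y : A.wt Y) :
    (A.mu X Y (x ⊗ₜ y)).1 = (tensor X Y).act A.mul (tmul x.1 y.1) := rfl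

variable {A}

theorem mu_surjective (hA : A.IsStrong k) (X Y : LinRep k C) :
    Function.Surjective (A.mu X Y) := by
  -- the elements of `(X ⊗ Y)(E)` whose projection to the weight space is in the image
  let S : Submodule k ((tensor X Y).obj.obj A.E) :=
    ((LinearMap.range (A.mu X Y)).map (A.wt (tensor X Y)).subtype).comap
      ((tensor X Y).obj.map A.e).hom
  have hS : S = ⊤ := tensor_span A.E S fun V W f x y => by
    obtain ⟨t, ht⟩ := (hA.pair_bijective V W).2
      ⟨f ≫ A.e, by rw [mem_homWt, Category.assoc, A.e_e]⟩
    have h : (A.mu X Y (TensorProduct.map (A.actBilin X V x) (A.actBilin Y W y) t)).1 =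
        (tensor X Y).act (A.pair k V W t).1 (tmul x y) := by
      clear ht
      induction t with
      | zero => simp only [map_zero]; exact (zero_act _).symm
      | add t t' h h' =>
        simp only [map_add, Submodule.coe_add, h, h', add_act]
      | tmul g g' =>
        rw [TensorProduct.map_tmul, mu_tmul_val, actBilin_val, actBilin_val, ← act_tmul,
          ← act_comp, pair_tmul_val]
    refine ⟨_, ⟨_, rfl⟩, h.trans ?_⟩
    rw [ht]
    exact act_comp f A.e _
  intro t
  have ht : t.1 ∈ S := hS ▸ Submodule.mem_top
  obtain ⟨_, ⟨z, rfl⟩, hz⟩ := ht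
  exact ⟨z, Subtype.ext (hz.trans (A.mem_wt.1 t.2))⟩

/-- The natural transformation `X ⊗ Y ⟶ Hom_k(homWt (-), wt X ⊗ wt Y)` given by `unpair`. -/
def toCoind (hA : A.IsStrong k) (X Y : LinRep k C) :
    tensor X Y ⟶ coindWt A (A.wt X ⊗[k] A.wt Y) :=
  desc
    { map := fun V W x y => unpair hA x y
      left := fun {V V' W} f x y => by
        have h := unpair_act hA f (𝟙 W) x y
        rw [act_id, tensorHom_id] at h
        exact h
      right := fun {V W W'} f x y => by
        have h := unpair_act hA (𝟙 V) f x y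
        rw [act_id, id_tensorHom] at h
        exact h }

theorem mu_injective (hA : A.IsStrong k) (X Y : LinRep k C) :
    Function.Injective (A.mu X Y) := by
  -- evaluation of `toCoind` at the idempotent is a retraction
  let ν : (tensor X Y).obj.obj A.E →ₗ[k] A.wt X ⊗[k] A.wt Y :=
    LinearMap.applyₗ (⟨A.e, A.e_e⟩ : A.homWt k A.E) ∘ₗ ((toCoind hA X Y).hom.app A.E).hom
  have hν : (ν ∘ₗ (A.wt (tensor X Y)).subtype) ∘ₗ A.mu X Y = LinearMap.id := by
    refine TensorProduct.ext' fun x y => ?_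
    show (show A.homWt k A.E →ₗ[k] A.wt X ⊗[k] A.wt Y from
      ap (toCoind hA X Y) ((tensor X Y).act A.mul (tmul x.1 y.1))) ⟨A.e, A.e_e⟩ = x ⊗ₜ y
    rw [ap_act, toCoind, desc_tmul, coindWt_act]
    have h : A.homWtPre k A.mul ⟨A.e, A.e_e⟩ =
        A.pair k A.E A.E (⟨A.e, A.e_e⟩ ⊗ₜ ⟨A.e, A.e_e⟩) := Subtype.ext A.mul_e
    rw [h, unpair_pair, TensorProduct.map_tmul]
    exact congrArg₂ (fun a b => a ⊗ₜ[k] b) (Subtype.ext x.2) (Subtype.ext y.2)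
  exact Function.LeftInverse.injective (g := ν ∘ₗ (A.wt (tensor X Y)).subtype)
    fun t => LinearMap.congr_fun hν t

theorem mu_wtRep (σ : G) (t : A.wt X ⊗[k] A.wt Y) :
    A.mu X Y ((A.wtRep X).tprod (A.wtRep Y) σ t) = A.wtRep (tensor X Y) σ (A.mu X Y t) := by
  induction t with
  | zero => simp only [map_zero]
  | add t t' h h' => simp only [map_add, h, h']
  | tmul x y =>
    refine Subtype.ext ?_
    rw [Representation.tprod_apply, TensorProduct.map_tmul, mu_tmul_val, wtRep_val, wtRep_val,
      wtRep_val, mu_tmul_val, ← act_tmul, ← act_comp, ← act_comp, A.mul_s]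

/-- The comparison isomorphism `wt X ⊗ wt Y ≅ wt (X ⊗ Y)`. -/
def muIso (hA : A.IsStrong k) (X Y : LinRep k C) :
    (A.wtFunctor k).obj X ⊗ (A.wtFunctor k).obj Y ≅ (A.wtFunctor k).obj (X ⊗ Y) :=
  Rep.mkIso (.mk (LinearEquiv.ofBijective (A.mu X Y) ⟨mu_injective hA X Y, mu_surjective hA X Y⟩)
    fun σ => LinearMap.ext fun t => mu_wtRep σ t)

/-- The comparison isomorphism `k ≅ wt I` for the unit object. -/
def epsIso (hA : A.IsStrong k) :
    𝟙_ (Rep.{u} k G) ≅ (A.wtFunctor k).obj (𝟙_ (LinRep k C)) :=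
  Rep.mkIso (.mk (LinearEquiv.ofBijective (A.unitMap k) hA.unitMap_bijective :
      k ≃ₗ[k] A.wt (unit k C))
    fun σ => LinearMap.ext fun r => Subtype.ext <| by
      show r • (A.one ≫ A.e) = (r • (A.one ≫ A.e)) ≫ A.s σ
      rw [Linear.smul_comp, Category.assoc, ← A.s_e, ← Category.assoc, A.one_s])

theorem rep_tensor_hom_ext {A B R : Rep.{u} k G} {f g : A ⊗ B ⟶ R}
    (h : ∀ (a : A.V) (b : B.V), f.hom (a ⊗ₜ[k] b) = g.hom (a ⊗ₜ[k] b)) : f = g :=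
  Rep.hom_ext (Representation.IntertwiningMap.ext (TensorProduct.ext' h))

theorem rep_tensor_hom_ext₃ {A B D R : Rep.{u} k G} {f g : (A ⊗ B) ⊗ D ⟶ R}
    (h : ∀ (a : A.V) (b : B.V) (d : D.V),
      f.hom ((a ⊗ₜ[k] b) ⊗ₜ[k] d) = g.hom ((a ⊗ₜ[k] b) ⊗ₜ[k] d)) : f = g :=
  Rep.hom_ext (Representation.IntertwiningMap.ext (TensorProduct.ext_threefold h))

/-- The weight space functor is strong monoidal. -/
def coreMonoidal (hA : A.IsStrong k) : (A.wtFunctor k).CoreMonoidal where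
  εIso := epsIso hA
  μIso := muIso hA
  μIso_hom_natural_left {X Y} f Z := rep_tensor_hom_ext fun x z => Subtype.ext <| by
    show (tensor Y Z).act A.mul (tmul (ap f x.1) z.1) =
      ap (tensorMap f (𝟙 Z)) ((tensor X Z).act A.mul (tmul x.1 z.1))
    rw [ap_act, tensorMap_tmul, ap_id]
  μIso_hom_natural_right {X Y} Z f := rep_tensor_hom_ext fun z x => Subtype.ext <| by
    show (tensor Z Y).act A.mul (tmul z.1 (ap f x.1)) =
      ap (tensorMap (𝟙 Z) f) ((tensor Z X).act A.mul (tmul z.1 x.1))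
    rw [ap_act, tensorMap_tmul, ap_id]
  associativity X Y Z := rep_tensor_hom_ext₃ fun x y z => Subtype.ext <| by
    show ap (assocHom X Y Z) ((tensor (tensor X Y) Z).act A.mul
        (tmul ((tensor X Y).act A.mul (tmul x.1 y.1)) z.1)) =
      (tensor X (tensor Y Z)).act A.mul
        (tmul x.1 ((tensor Y Z).act A.mul (tmul y.1 z.1)))
    rw [← act_tmul_left, ← act_tmul_right, ← act_comp, ← act_comp, ap_act, assocHom_tmul,
      ← act_comp, A.mul_assoc, Iso.inv_hom_id_assoc]
  left_unitality X := rep_tensor_hom_ext fun r x => Subtype.ext <| by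
    show r • x.1 = ap (leftHom X) ((tensor (unit k C) X).act A.mul
      (tmul (unitElt k (r • (A.one ≫ A.e))) x.1))
    rw [ap_act, leftHom_tmul, ← act_comp, unitMor_unitElt]
    -- the comparison map uses `e ∘ one`, a unit only up to `e`, which fixes `x`
    conv_rhs => rw [← A.mem_wt.1 x.2, ← act_comp]
    have h : A.e ≫ ((λ_ A.E).inv ≫ (r • (A.one ≫ A.e)) ▷ A.E) ≫ A.mul = r • A.e := by
      rw [MonoidalLinear.smul_whiskerRight, Linear.comp_smul, Linear.smul_comp, Linear.comp_smul,
        Category.assoc, leftUnitor_inv_naturality_assoc, ← id_tensorHom, ← tensorHom_id,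
        tensorHom_comp_tensorHom_assoc, Category.id_comp, Category.comp_id,
        A.one_e_tensor_e_mul, Iso.inv_hom_id_assoc]
    rw [h, smul_act, A.mem_wt.1 x.2]
  right_unitality X := rep_tensor_hom_ext fun x r => Subtype.ext <| by
    show r • x.1 = ap (rightHom X) ((tensor X (unit k C)).act A.mul
      (tmul x.1 (unitElt k (r • (A.one ≫ A.e)))))
    rw [ap_act, rightHom_tmul, ← act_comp, unitMor_unitElt]
    -- the comparison map uses `e ∘ one`, a unit only up to `e`, which fixes `x`
    conv_rhs => rw [← A.mem_wt.1 x.2, ← act_comp]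
    have h : A.e ≫ ((ρ_ A.E).inv ≫ A.E ◁ (r • (A.one ≫ A.e))) ≫ A.mul = r • A.e := by
      rw [MonoidalLinear.whiskerLeft_smul, Linear.comp_smul, Linear.smul_comp, Linear.comp_smul,
        Category.assoc, rightUnitor_inv_naturality_assoc, ← id_tensorHom, ← tensorHom_id,
        tensorHom_comp_tensorHom_assoc, Category.id_comp, Category.comp_id,
        A.e_tensor_one_e_mul, Iso.inv_hom_id_assoc]
    rw [h, smul_act, A.mem_wt.1 x.2]

end Tensor
end WeightAlgebra

/-! ### Symmetrization of tensors -/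

section Symmetrization

variable {k : Type u} [CommRing k] {d : ℕ}
  {M N P : Type u} [AddCommGroup M] [Module k M] [AddCommGroup N] [Module k N]
  [AddCommGroup P] [Module k P]

theorem permute_permute (σ τ : Equiv.Perm (Fin d)) (x : ⨂[k] _ : Fin d, M) :
    permute k d M τ (permute k d M σ x) = permute k d M (σ * τ) x :=
  (permute_mul k d M σ τ x).symm

variable (k d M) in
/-- The symmetrization `t ↦ ∑ σ, t σ`. -/
def symmetrize : (⨂[k] _ : Fin d, M) →ₗ[k] dividedPower k d M :=
  (∑ σ : Equiv.Perm (Fin d), permute k d M σ).codRestrict (dividedPower k d M) fun t τ => by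
    simp only [LinearMap.sum_apply, map_sum, permute_permute]
    exact Fintype.sum_equiv (Equiv.mulRight τ) _ _ fun _ => rfl

theorem symmetrize_val (t : ⨂[k] _ : Fin d, M) :
    (symmetrize k d M t).1 = ∑ σ : Equiv.Perm (Fin d), permute k d M σ t :=
  LinearMap.sum_apply _ _ _

theorem symmetrize_permute (t : ⨂[k] _ : Fin d, M) (τ : Equiv.Perm (Fin d)) :
    symmetrize k d M (permute k d M τ t) = symmetrize k d M t := by
  refine Subtype.ext ?_
  simp only [symmetrize_val, permute_permute]
  exact Fintype.sum_equiv (Equiv.mulLeft τ) _ _ fun _ => rfl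

theorem powMap₂_symmetrize_left (B : M →ₗ[k] N →ₗ[k] P) (t : ⨂[k] _ : Fin d, M)
    {y : ⨂[k] _ : Fin d, N} (hy : y ∈ dividedPower k d N) :
    powMap₂ d B (symmetrize k d M t).1 y = (symmetrize k d P (powMap₂ d B t y)).1 := by
  simp only [symmetrize_val, permute_powMap₂, map_sum, LinearMap.sum_apply]
  exact Finset.sum_congr rfl fun σ _ => by rw [hy σ]

theorem powMap₂_symmetrize_right (B : M →ₗ[k] N →ₗ[k] P) {x : ⨂[k] _ : Fin d, M}
    (hx : x ∈ dividedPower k d M) (t : ⨂[k] _ : Fin d, N) :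
    powMap₂ d B x (symmetrize k d N t).1 = (symmetrize k d P (powMap₂ d B x t)).1 := by
  simp only [symmetrize_val, permute_powMap₂, map_sum]
  exact Finset.sum_congr rfl fun σ _ => by rw [hx σ]

/-- If `B (m i) (n j) = 0` for `i ≠ j`, then only the identity permutation contributes to the
product of `m₁ ⊗ ⋯ ⊗ m_d` with the symmetrization of `n₁ ⊗ ⋯ ⊗ n_d`. -/
theorem powMap₂_tprod_symmetrize (B : M →ₗ[k] N →ₗ[k] P) (m : Fin d → M) (n : Fin d → N)
    (h : ∀ i j, i ≠ j → B (m i) (n j) = 0) :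
    powMap₂ d B (PiTensorProduct.tprod k m) (symmetrize k d N (PiTensorProduct.tprod k n)).1 =
      PiTensorProduct.tprod k fun i => B (m i) (n i) := by
  simp only [symmetrize_val, map_sum, permute_tprod, powMap₂_tprod]
  rw [Fintype.sum_eq_single 1]
  · rfl
  · intro σ hσ
    obtain ⟨i, hi⟩ : ∃ i, σ i ≠ i := DFunLike.exists_ne hσ
    exact MultilinearMap.map_coord_zero _ i (h i (σ i) hi.symm)

/-- The variant of `powMap₂_tprod_symmetrize` with the symmetrization in the first argument. -/
theorem powMap₂_symmetrize_tprod (B : M →ₗ[k] N →ₗ[k] P) (m : Fin d → M) (n : Fin d → N)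
    (h : ∀ i j, i ≠ j → B (m i) (n j) = 0) :
    powMap₂ d B (symmetrize k d M (PiTensorProduct.tprod k m)).1 (PiTensorProduct.tprod k n) =
      PiTensorProduct.tprod k fun i => B (m i) (n i) := by
  simp only [symmetrize_val, map_sum, LinearMap.sum_apply, permute_tprod, powMap₂_tprod]
  rw [Fintype.sum_eq_single 1]
  · rfl
  · intro σ hσ
    obtain ⟨i, hi⟩ : ∃ i, σ i ≠ i := DFunLike.exists_ne hσ
    exact MultilinearMap.map_coord_zero _ i (h (σ i) i hi)

end Symmetrization

/-- A power of the tensor unit: an object `E` which is a biproduct of copies of the tensor unit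
indexed by `Fin d`. -/
structure UnitPower (D : Type v) [Category.{u} D] [Preadditive D] [MonoidalCategory D]
    (d : ℕ) where
  /-- the underlying object -/
  E : D
  /-- the inclusions of the summands -/
  inj : Fin d → (𝟙_ D ⟶ E)
  /-- the projections to the summands -/
  proj : Fin d → (E ⟶ 𝟙_ D)
  inj_proj_self (i : Fin d) : inj i ≫ proj i = 𝟙 _
  inj_proj_ne (i j : Fin d) (h : i ≠ j) : inj i ≫ proj j = 0
  total : ∑ i, proj i ≫ inj i = 𝟙 E

attribute [simp] UnitPower.inj_proj_self

namespace UnitPower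

variable {D : Type v} [Category.{u} D] [Preadditive D] [MonoidalCategory D] {d : ℕ}
  (A : UnitPower D d)

theorem hom_ext {V : D} {f g : V ⟶ A.E} (h : ∀ i, f ≫ A.proj i = g ≫ A.proj i) : f = g := by
  rw [← Category.comp_id f, ← Category.comp_id g, ← A.total, Preadditive.comp_sum,
    Preadditive.comp_sum]
  exact Finset.sum_congr rfl fun i _ => by rw [← Category.assoc, h, Category.assoc]

/-- The morphism to a power of the tensor unit with given components. -/
def lift {V : D} (f : Fin d → (V ⟶ 𝟙_ D)) : V ⟶ A.E := ∑ i, f i ≫ A.inj i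

theorem lift_proj {V : D} (f : Fin d → (V ⟶ 𝟙_ D)) (i : Fin d) :
    A.lift f ≫ A.proj i = f i := by
  rw [lift, Preadditive.sum_comp, Fintype.sum_eq_single i]
  · simp
  · intro j hj
    rw [Category.assoc, A.inj_proj_ne j i hj, comp_zero]

/-- The componentwise multiplication on a power of the tensor unit. -/
def mul : A.E ⊗ A.E ⟶ A.E := A.lift fun i => (A.proj i ⊗ₘ A.proj i) ≫ (λ_ (𝟙_ D)).hom

/-- The unit `(1, …, 1)` of the componentwise multiplication. -/
def one : 𝟙_ D ⟶ A.E := A.lift fun _ => 𝟙 _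

/-- The action of the symmetric group, sending the summand `i` to the summand `σ i`. -/
def perm (σ : Equiv.Perm (Fin d)) : A.E ⟶ A.E := A.lift fun i => A.proj (σ⁻¹ i)

theorem mul_proj (i : Fin d) :
    A.mul ≫ A.proj i = (A.proj i ⊗ₘ A.proj i) ≫ (λ_ (𝟙_ D)).hom := A.lift_proj _ i

theorem one_proj (i : Fin d) : A.one ≫ A.proj i = 𝟙 _ := A.lift_proj _ i

theorem perm_proj (σ : Equiv.Perm (Fin d)) (i : Fin d) :
    A.perm σ ≫ A.proj i = A.proj (σ⁻¹ i) := A.lift_proj _ i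

theorem mul_assoc : (A.mul ⊗ₘ 𝟙 A.E) ≫ A.mul =
    (α_ A.E A.E A.E).hom ≫ (𝟙 A.E ⊗ₘ A.mul) ≫ A.mul := A.hom_ext fun i => by
  have h₁ : (((A.proj i ⊗ₘ A.proj i) ≫ (λ_ (𝟙_ D)).hom) ⊗ₘ A.proj i) ≫ (λ_ (𝟙_ D)).hom =
      ((A.proj i ⊗ₘ A.proj i) ⊗ₘ A.proj i) ≫ (ρ_ (𝟙_ D)).hom ▷ 𝟙_ D ≫ (λ_ (𝟙_ D)).hom := by
    rw [← unitors_equal, ← tensorHom_id, tensorHom_comp_tensorHom_assoc, Category.comp_id]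
  have h₂ : (A.proj i ⊗ₘ ((A.proj i ⊗ₘ A.proj i) ≫ (λ_ (𝟙_ D)).hom)) ≫ (λ_ (𝟙_ D)).hom =
      (A.proj i ⊗ₘ (A.proj i ⊗ₘ A.proj i)) ≫ 𝟙_ D ◁ (λ_ (𝟙_ D)).hom ≫ (λ_ (𝟙_ D)).hom := by
    rw [← id_tensorHom, tensorHom_comp_tensorHom_assoc, Category.comp_id]
  simp only [Category.assoc, mul_proj, tensorHom_comp_tensorHom_assoc, Category.id_comp]
  rw [h₁, h₂, ← associator_naturality_assoc, triangle_assoc]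

theorem one_mul : (A.one ⊗ₘ 𝟙 A.E) ≫ A.mul = (λ_ A.E).hom := A.hom_ext fun i => by
  simp only [Category.assoc, mul_proj, tensorHom_comp_tensorHom_assoc, Category.id_comp,
    one_proj, id_tensorHom, leftUnitor_naturality]

theorem mul_one : (𝟙 A.E ⊗ₘ A.one) ≫ A.mul = (ρ_ A.E).hom := A.hom_ext fun i => by
  simp only [Category.assoc, mul_proj, tensorHom_comp_tensorHom_assoc, Category.id_comp,
    one_proj, tensorHom_id, unitors_equal, rightUnitor_naturality]

theorem perm_one : A.perm 1 = 𝟙 A.E := A.hom_ext fun i => by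
  rw [perm_proj, Category.id_comp]; rfl

theorem perm_mul (σ τ : Equiv.Perm (Fin d)) : A.perm (σ * τ) = A.perm τ ≫ A.perm σ :=
  A.hom_ext fun i => by
    rw [Category.assoc, perm_proj, perm_proj, perm_proj, mul_inv_rev]; rfl

theorem mul_perm (σ : Equiv.Perm (Fin d)) :
    A.mul ≫ A.perm σ = (A.perm σ ⊗ₘ A.perm σ) ≫ A.mul := A.hom_ext fun i => by
  simp only [Category.assoc, mul_proj, perm_proj, tensorHom_comp_tensorHom_assoc]

theorem one_perm (σ : Equiv.Perm (Fin d)) : A.one ≫ A.perm σ = A.one := A.hom_ext fun i => by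
  simp only [Category.assoc, perm_proj, one_proj]

theorem inj_perm (σ : Equiv.Perm (Fin d)) (i : Fin d) : A.inj i ≫ A.perm σ = A.inj (σ i) :=
  A.hom_ext fun j => by
    rw [Category.assoc, perm_proj]
    by_cases h : σ i = j
    · subst h
      simp
    · rw [A.inj_proj_ne _ _ h, A.inj_proj_ne]
      rintro rfl
      simp at h

variable [MonoidalPreadditive D]

theorem inj_mul_self (i : Fin d) {V W : D} (f : V ⟶ 𝟙_ D) (g : W ⟶ 𝟙_ D) :
    ((f ≫ A.inj i) ⊗ₘ (g ≫ A.inj i)) ≫ A.mul = ((f ⊗ₘ g) ≫ (λ_ (𝟙_ D)).hom) ≫ A.inj i :=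
  A.hom_ext fun j => by
    simp only [Category.assoc, mul_proj, tensorHom_comp_tensorHom_assoc]
    by_cases h : i = j
    · subst h
      simp
    · simp [A.inj_proj_ne i j h]

theorem inj_mul_ne {i j : Fin d} (hij : i ≠ j) {V W : D} (f : V ⟶ 𝟙_ D) (g : W ⟶ 𝟙_ D) :
    ((f ≫ A.inj i) ⊗ₘ (g ≫ A.inj j)) ≫ A.mul = 0 :=
  A.hom_ext fun l => by
    simp only [Category.assoc, mul_proj, tensorHom_comp_tensorHom_assoc]
    by_cases h : i = l
    · subst h
      simp [A.inj_proj_ne j i hij.symm]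
    · simp [A.inj_proj_ne i l h]

end UnitPower

/-! ### The weight algebra in the category of divided powers -/

section Sym

variable (k : Type u) [CommRing k] {D : Type v} [Category.{u} D] [Preadditive D] [Linear k D]
  (d : ℕ)

/-- The morphism of the category of divided powers given by symmetrizing the family of morphisms
`f i`. -/
def symHom {V W : D} (f : Fin d → (V ⟶ W)) :
    (GammaCat.γ k d D).obj V ⟶ (GammaCat.γ k d D).obj W :=
  symmetrize k d (V ⟶ W) (PiTensorProduct.tprod k f)

variable {k d}

theorem symHom_perm {V W : D} (f : Fin d → (V ⟶ W)) (σ : Equiv.Perm (Fin d)) :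
    symHom k d (fun i => f (σ i)) = symHom k d f := by
  refine Eq.trans ?_ (symmetrize_permute (PiTensorProduct.tprod k f) σ)
  rw [permute_tprod]
  rfl

theorem symHom_γ {U V W : D} (f : Fin d → (U ⟶ V)) (g : V ⟶ W) :
    symHom k d f ≫ (GammaCat.γ k d D).map g = symHom k d fun i => f i ≫ g :=
  Subtype.ext <| (powMap₂_symmetrize_left _ _ ((GammaCat.γ k d D).map g).2).trans <| by
    exact congrArg (fun t => (symmetrize k d (U ⟶ W) t).1) (powMap₂_tprod d _ f fun _ => g)

theorem γ_symHom {U V W : D} (f : U ⟶ V) (g : Fin d → (V ⟶ W)) :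
    (GammaCat.γ k d D).map f ≫ symHom k d g = symHom k d fun i => f ≫ g i :=
  Subtype.ext <| (powMap₂_symmetrize_right _ ((GammaCat.γ k d D).map f).2 _).trans <| by
    exact congrArg (fun t => (symmetrize k d (U ⟶ W) t).1) (powMap₂_tprod d _ (fun _ => f) g)

/-- If `f i ≫ g j = 0` for `i ≠ j`, then symmetrization is multiplicative. -/
theorem symHom_comp {U V W : D} (f : Fin d → (U ⟶ V)) (g : Fin d → (V ⟶ W))
    (h : ∀ i j, i ≠ j → f i ≫ g j = 0) :
    symHom k d f ≫ symHom k d g = symHom k d fun i => f i ≫ g i :=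
  Subtype.ext <| (powMap₂_symmetrize_left _ _ (symHom k d g).2).trans <| by
    exact congrArg (fun t => (symmetrize k d (U ⟶ W) t).1) (powMap₂_tprod_symmetrize _ f g h)

variable [MonoidalCategory D] [MonoidalPreadditive D] [MonoidalLinear k D]

theorem symHom_tensor_comp_γ {V V' W W' Z : D} (f : Fin d → (V ⟶ V')) (g : Fin d → (W ⟶ W'))
    (m : V' ⊗ W' ⟶ Z) (h : ∀ i j, i ≠ j → (f i ⊗ₘ g j) ≫ m = 0) :
    (symHom k d f ⊗ₘ symHom k d g) ≫ (GammaCat.γ k d D).map m =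
      symHom k d fun i => (f i ⊗ₘ g i) ≫ m := by
  -- the composite is the product of the two symmetrizations for the bilinear map `f ⊗ g ≫ m`
  let B : (V ⟶ V') →ₗ[k] (W ⟶ W') →ₗ[k] (V ⊗ W ⟶ Z) :=
    (GammaCat.tensorBilin V V' W W').compr₂ (Linear.rightComp k (V ⊗ W) m)
  have hB : ∀ (x : ⨂[k] _ : Fin d, (V ⟶ V')) (y : ⨂[k] _ : Fin d, (W ⟶ W')),
      powMap₂ d (GammaCat.compBilin (k := k) (V ⊗ W) (V' ⊗ W') Z)
        (powMap₂ d (GammaCat.tensorBilin V V' W W') x y) (PiTensorProduct.tprod k fun _ => m) =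
      powMap₂ d B x y := fun x y => by
    induction x using PiTensorProduct.induction_on with
    | add x₁ x₂ h₁ h₂ => simp only [map_add, LinearMap.add_apply, h₁, h₂]
    | smul_tprod r a =>
    induction y using PiTensorProduct.induction_on with
    | add x₁ x₂ h₁ h₂ => simp only [map_add, LinearMap.add_apply, h₁, h₂]
    | smul_tprod s b =>
      simp only [map_smul, LinearMap.smul_apply, powMap₂_tprod]
      rfl
  refine Subtype.ext ((hB _ _).trans ((powMap₂_symmetrize_left _ _ (symHom k d g).2).trans ?_))
  exact congrArg (fun t => (symmetrize k d (V ⊗ W ⟶ Z) t).1) (powMap₂_tprod_symmetrize B f g h)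

theorem γ_whiskerRight {V V' : D} (f : V ⟶ V') (W : D) :
    (GammaCat.γ k d D).map f ▷ (GammaCat.γ k d D).obj W =
      (GammaCat.γ k d D).map (f ⊗ₘ 𝟙 W) :=
  (tensorHom_id _ _).symm.trans (GammaCat.γ_tensor f (𝟙 W))

theorem γ_whiskerLeft (V : D) {W W' : D} (f : W ⟶ W') :
    (GammaCat.γ k d D).obj V ◁ (GammaCat.γ k d D).map f =
      (GammaCat.γ k d D).map (𝟙 V ⊗ₘ f) :=
  (id_tensorHom _ _).symm.trans (GammaCat.γ_tensor (𝟙 V) f)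

end Sym

namespace UnitPower

variable {k : Type u} [CommRing k] {D : Type v} [Category.{u} D] [Preadditive D] [Linear k D]
  [MonoidalCategory D] {d : ℕ} (A : UnitPower D d)

variable (k) in
/-- The idempotent given by symmetrizing the projections of `E` to its summands. -/
def idem : (GammaCat.γ k d D).obj A.E ⟶ (GammaCat.γ k d D).obj A.E :=
  symHom k d fun i => A.proj i ≫ A.inj i

theorem proj_inj_comp_ne {i j : Fin d} (h : i ≠ j) {V W : D} (f : V ⟶ 𝟙_ D) (g : 𝟙_ D ⟶ W) :
    (f ≫ A.inj i) ≫ A.proj j ≫ g = 0 := by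
  rw [Category.assoc, ← Category.assoc (A.inj i), A.inj_proj_ne i j h, zero_comp, comp_zero]

theorem proj_inj_comp_self (i : Fin d) {V W : D} (f : V ⟶ 𝟙_ D) (g : 𝟙_ D ⟶ W) :
    (f ≫ A.inj i) ≫ A.proj i ≫ g = f ≫ g := by
  rw [Category.assoc, ← Category.assoc (A.inj i), A.inj_proj_self i, Category.id_comp]

theorem symHom_inj_idem {V : D} (f : Fin d → (V ⟶ 𝟙_ D)) :
    symHom k d (fun i => f i ≫ A.inj i) ≫ A.idem k = symHom k d fun i => f i ≫ A.inj i := by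
  rw [idem, symHom_comp _ _ fun i j h => A.proj_inj_comp_ne h _ _]
  simp only [proj_inj_comp_self]

variable [MonoidalPreadditive D] [MonoidalLinear k D]

variable (k) in
/-- The weight algebra in the category of divided powers whose underlying object is a power of the
tensor unit with componentwise multiplication, and whose idempotent cuts out the weight
`(1, …, 1)`. -/
def weightAlgebra : WeightAlgebra (GammaCat k d D) (Equiv.Perm (Fin d)) where
  E := (GammaCat.γ k d D).obj A.E
  mul := (GammaCat.γ k d D).map A.mul
  one := (GammaCat.γ k d D).map A.one
  e := A.idem k
  s σ := (GammaCat.γ k d D).map (A.perm σ)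
  mul_assoc := (congrArg (· ≫ (GammaCat.γ k d D).map A.mul) (γ_whiskerRight A.mul A.E)).trans <|
    ((GammaCat.γ k d D).map_comp _ _).symm.trans <|
    (congrArg (GammaCat.γ k d D).map A.mul_assoc).trans <|
    ((GammaCat.γ k d D).map_comp _ _).trans <|
    congrArg ((GammaCat.γ k d D).map (α_ A.E A.E A.E).hom ≫ ·) <|
    ((GammaCat.γ k d D).map_comp _ _).trans <|
    congrArg (· ≫ (GammaCat.γ k d D).map A.mul) (γ_whiskerLeft A.E A.mul).symm
  one_mul := (congrArg (· ≫ (GammaCat.γ k d D).map A.mul) (γ_whiskerRight A.one A.E)).trans <|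
    ((GammaCat.γ k d D).map_comp _ _).symm.trans <| congrArg (GammaCat.γ k d D).map A.one_mul
  mul_one := (congrArg (· ≫ (GammaCat.γ k d D).map A.mul) (γ_whiskerLeft A.E A.one)).trans <|
    ((GammaCat.γ k d D).map_comp _ _).symm.trans <| congrArg (GammaCat.γ k d D).map A.mul_one
  e_e := A.symHom_inj_idem _
  mul_e := (γ_symHom A.mul _).trans <| Eq.trans
    (congrArg (symHom k d) <| funext fun i => by
      rw [inj_mul_self, ← mul_proj, Category.assoc])
    (symHom_tensor_comp_γ _ _ A.mul fun i j h => A.inj_mul_ne h _ _).symm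
  s_one := (congrArg (GammaCat.γ k d D).map A.perm_one).trans ((GammaCat.γ k d D).map_id _)
  s_mul σ τ := (congrArg (GammaCat.γ k d D).map (A.perm_mul σ τ)).trans
    ((GammaCat.γ k d D).map_comp _ _)
  s_e σ := by
    rw [idem, γ_symHom, symHom_γ, ← symHom_perm _ σ]
    congr 1
    funext i
    rw [Category.assoc, inj_perm, ← Category.assoc, perm_proj]
    simp
  mul_s σ := ((GammaCat.γ k d D).map_comp _ _).symm.trans <|
    (congrArg (GammaCat.γ k d D).map (A.mul_perm σ)).trans <|
    ((GammaCat.γ k d D).map_comp _ _).trans <|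
    congrArg (· ≫ (GammaCat.γ k d D).map A.mul) (GammaCat.γ_tensor _ _).symm
  one_s σ := ((GammaCat.γ k d D).map_comp _ _).symm.trans <|
    congrArg (GammaCat.γ k d D).map (A.one_perm σ)

end UnitPower

/-! ### Dual bases and strong monoidality -/

/-- A finite dual basis of an object `V` of a monoidal preadditive category: finitely many
morphisms `𝟙 ⟶ V` and `V ⟶ 𝟙` exhibiting `V` as a retract of a power of the tensor unit. The
elements need not be independent. -/
structure UnitDualBasis {D : Type v} [Category.{u} D] [Preadditive D] [MonoidalCategory D]
    (V : D) where
  /-- the index type -/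
  ι : Type
  /-- the index type is finite -/
  fintype : Fintype ι
  /-- the elements -/
  vec : ι → (𝟙_ D ⟶ V)
  /-- the coordinates -/
  covec : ι → (V ⟶ 𝟙_ D)
  total : ∑ j, covec j ≫ vec j = 𝟙 V

attribute [instance] UnitDualBasis.fintype

namespace UnitDualBasis

variable {D : Type v} [Category.{u} D] [Preadditive D] [MonoidalCategory D]

variable (D) in
/-- The dual basis of the tensor unit. -/
def unit : UnitDualBasis (𝟙_ D) where
  ι := Unit
  fintype := inferInstance
  vec _ := 𝟙 _
  covec _ := 𝟙 _
  total := by simp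

/-- The tensor product of two dual bases. -/
def tensor [MonoidalPreadditive D] {V W : D} (b : UnitDualBasis V) (c : UnitDualBasis W) :
    UnitDualBasis (V ⊗ W) where
  ι := b.ι × c.ι
  fintype := inferInstance
  vec j := (λ_ (𝟙_ D)).inv ≫ (b.vec j.1 ⊗ₘ c.vec j.2)
  covec j := (b.covec j.1 ⊗ₘ c.covec j.2) ≫ (λ_ (𝟙_ D)).hom
  total := by
    simp only [Category.assoc, Iso.hom_inv_id_assoc, tensorHom_comp_tensorHom]
    rw [Fintype.sum_prod_type]
    simp only [← tensor_sum, ← sum_tensor, b.total, c.total, id_tensorHom_id]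

end UnitDualBasis

namespace UnitPower

variable {k : Type u} [CommRing k] {D : Type v} [Category.{u} D] [Preadditive D] [Linear k D]
  [MonoidalCategory D] {d : ℕ} (A : UnitPower D d)

theorem scalar_smul_id {c : (𝟙_ D ⟶ 𝟙_ D) ≃ₗ[k] k} (hc : c (𝟙 _) = 1) (h : 𝟙_ D ⟶ 𝟙_ D) :
    c h • 𝟙 (𝟙_ D) = h :=
  c.injective (by rw [map_smul, hc, smul_eq_mul, _root_.mul_one])

/-- The pairing of `f₁ ⊗ ⋯ ⊗ f_d` with a family `v`: the product over `i` of the scalars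
`v i ≫ f i ≫ proj i`, where `c` identifies the endomorphisms of the tensor unit with scalars. -/
def coef (c : (𝟙_ D ⟶ 𝟙_ D) ≃ₗ[k] k) {V : D} (v : Fin d → (𝟙_ D ⟶ V)) :
    (⨂[k] _ : Fin d, (V ⟶ A.E)) →ₗ[k] k :=
  PiTensorProduct.lift ((MultilinearMap.mkPiAlgebra k (Fin d) k).compLinearMap fun i =>
    c.toLinearMap ∘ₗ Linear.leftComp k _ (v i) ∘ₗ Linear.rightComp k V (A.proj i))

theorem coef_tprod (c : (𝟙_ D ⟶ 𝟙_ D) ≃ₗ[k] k) {V : D} (v : Fin d → (𝟙_ D ⟶ V))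
    (f : Fin d → (V ⟶ A.E)) :
    A.coef c v (PiTensorProduct.tprod k f) = ∏ i, c (v i ≫ f i ≫ A.proj i) := by
  rw [coef, PiTensorProduct.lift.tprod]
  rfl

variable (k) in
/-- Composition of the `i`-th tensor factor with the projection of `E` to its `i`-th summand, for
all `i`. -/
def cut (V : D) : (⨂[k] _ : Fin d, (V ⟶ A.E)) →ₗ[k] (⨂[k] _ : Fin d, (V ⟶ A.E)) :=
  (powMap₂ d (GammaCat.compBilin (k := k) V A.E A.E)).flip
    (PiTensorProduct.tprod k fun i => A.proj i ≫ A.inj i)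

theorem cut_tprod {V : D} (f : Fin d → (V ⟶ A.E)) :
    A.cut k V (PiTensorProduct.tprod k f) =
      PiTensorProduct.tprod k fun i => (f i ≫ A.proj i) ≫ A.inj i := by
  refine (powMap₂_tprod d _ f _).trans (congrArg _ (funext fun i => ?_))
  exact (Category.assoc _ _ _).symm

/-- Expansion of the tensor factors in a dual basis. -/
theorem cut_eq_sum {c : (𝟙_ D ⟶ 𝟙_ D) ≃ₗ[k] k} (hc : c (𝟙 _) = 1) {V : D} (b : UnitDualBasis V)
    (t : ⨂[k] _ : Fin d, (V ⟶ A.E)) :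
    A.cut k V t = ∑ I : Fin d → b.ι, A.coef c (fun i => b.vec (I i)) t •
      PiTensorProduct.tprod k fun i => b.covec (I i) ≫ A.inj i := by
  induction t using PiTensorProduct.induction_on with
  | add x y hx hy => simp only [map_add, add_smul, Finset.sum_add_distrib, hx, hy]
  | smul_tprod r f =>
    simp only [map_smul, smul_assoc, ← Finset.smul_sum, cut_tprod, coef_tprod]
    congr 1
    have h : ∀ i, (f i ≫ A.proj i) ≫ A.inj i =
        ∑ j, c (b.vec j ≫ f i ≫ A.proj i) • (b.covec j ≫ A.inj i) := fun i => by
      conv_lhs => rw [← Category.id_comp (f i ≫ A.proj i), ← b.total]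
      rw [Preadditive.sum_comp, Preadditive.sum_comp]
      refine Finset.sum_congr rfl fun j _ => ?_
      rw [Category.assoc (b.covec j), ← scalar_smul_id hc (b.vec j ≫ f i ≫ A.proj i),
        map_smul, hc, smul_eq_mul, _root_.mul_one, Linear.comp_smul, Linear.smul_comp,
        Category.comp_id]
    simp only [h]
    rw [MultilinearMap.map_sum]
    exact Finset.sum_congr rfl fun I _ => MultilinearMap.map_smul_univ _ _ _

variable [MonoidalPreadditive D] [MonoidalLinear k D]

theorem coef_pair {c : (𝟙_ D ⟶ 𝟙_ D) ≃ₗ[k] k} (hc : c (𝟙 _) = 1) {V W : D}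
    (v : Fin d → (𝟙_ D ⟶ V)) (w : Fin d → (𝟙_ D ⟶ W))
    (x : ⨂[k] _ : Fin d, (V ⟶ A.E)) (y : ⨂[k] _ : Fin d, (W ⟶ A.E)) :
    A.coef c (fun i => (λ_ (𝟙_ D)).inv ≫ (v i ⊗ₘ w i))
        (powMap₂ d (GammaCat.compBilin (k := k) (V ⊗ W) (A.E ⊗ A.E) A.E)
          (powMap₂ d (GammaCat.tensorBilin V A.E W A.E) x y)
          (PiTensorProduct.tprod k fun _ => A.mul)) =
      A.coef c v x * A.coef c w y := by
  induction x using PiTensorProduct.induction_on with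
  | add x₁ x₂ h₁ h₂ => simp only [map_add, LinearMap.add_apply, h₁, h₂, add_mul]
  | smul_tprod r f =>
  induction y using PiTensorProduct.induction_on with
  | add x₁ x₂ h₁ h₂ => simp only [map_add, LinearMap.add_apply, h₁, h₂, mul_add]
  | smul_tprod s g =>
    simp only [map_smul, LinearMap.smul_apply, powMap₂_tprod, coef_tprod, smul_eq_mul,
      GammaCat.compBilin_apply, GammaCat.tensorBilin_apply]
    have h : ∀ i, c (((λ_ (𝟙_ D)).inv ≫ (v i ⊗ₘ w i)) ≫ ((f i ⊗ₘ g i) ≫ A.mul) ≫ A.proj i) =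
        c (v i ≫ f i ≫ A.proj i) * c (w i ≫ g i ≫ A.proj i) := fun i => by
      simp only [Category.assoc, mul_proj, tensorHom_comp_tensorHom_assoc]
      rw [← scalar_smul_id hc (v i ≫ f i ≫ A.proj i),
        ← scalar_smul_id hc (w i ≫ g i ≫ A.proj i)]
      simp [MonoidalCategory.tensorHom_def, hc, mul_comm]
    simp only [h, Finset.prod_mul_distrib]
    ring

/-- The symmetrization of a family of functionals `φ i`, each regarded as a map to the `i`-th summand
of `E`; it is fixed by the idempotent. -/
def symWt {V : D} (φ : Fin d → (V ⟶ 𝟙_ D)) :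
    (A.weightAlgebra k).homWt k ((GammaCat.γ k d D).obj V) :=
  ⟨symHom k d fun i => φ i ≫ A.inj i, A.symHom_inj_idem φ⟩

/-- The pairing `coef` on the morphisms to `E` fixed by the idempotent. -/
def coefWt (c : (𝟙_ D ⟶ 𝟙_ D) ≃ₗ[k] k) {V : D} (v : Fin d → (𝟙_ D ⟶ V)) :
    (A.weightAlgebra k).homWt k ((GammaCat.γ k d D).obj V) →ₗ[k] k :=
  A.coef c v ∘ₗ (dividedPower k d (V ⟶ A.E)).subtype ∘ₗ Submodule.subtype _

/-- The morphisms to `E` fixed by the idempotent expand in the symmetrized families of dual basis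
elements. -/
theorem homWt_eq_sum {c : (𝟙_ D ⟶ 𝟙_ D) ≃ₗ[k] k} (hc : c (𝟙 _) = 1) {V : D}
    (b : UnitDualBasis V) (f : (A.weightAlgebra k).homWt k ((GammaCat.γ k d D).obj V)) :
    f = ∑ I : Fin d → b.ι, A.coefWt c (fun i => b.vec (I i)) f •
      A.symWt fun i => b.covec (I i) := by
  have h₁ : f.1 = symmetrize k d (V ⟶ A.E) (A.cut k V f.1.1) := by
    refine ((A.weightAlgebra k).mem_homWt.1 f.2).symm.trans (Subtype.ext ?_)
    exact powMap₂_symmetrize_right _ f.1.2 _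
  refine Subtype.ext (h₁.trans ((congrArg _ (A.cut_eq_sum hc b f.1.1)).trans ?_))
  rw [map_sum, AddSubmonoidClass.coe_finsetSum]
  exact Finset.sum_congr rfl fun I _ => map_smul _ _ _

theorem pair_symWt {V W : D} (φ : Fin d → (V ⟶ 𝟙_ D)) (ψ : Fin d → (W ⟶ 𝟙_ D)) :
    (A.weightAlgebra k).pair k _ _ (A.symWt φ ⊗ₜ A.symWt ψ) =
      A.symWt fun i => (φ i ⊗ₘ ψ i) ≫ (λ_ (𝟙_ D)).hom :=
  Subtype.ext <| (symHom_tensor_comp_γ _ _ A.mul fun _ _ h => A.inj_mul_ne h _ _).trans <|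
    congrArg (symHom k d) <| funext fun i => A.inj_mul_self i _ _

theorem pair_bijective {c : (𝟙_ D ⟶ 𝟙_ D) ≃ₗ[k] k} (hc : c (𝟙 _) = 1) {V W : D}
    (b : UnitDualBasis V) (b' : UnitDualBasis W) :
    Function.Bijective ((A.weightAlgebra k).pair k ((GammaCat.γ k d D).obj V)
      ((GammaCat.γ k d D).obj W)) := by
  constructor
  · let r : (A.weightAlgebra k).homWt k ((GammaCat.γ k d D).obj (V ⊗ W)) →ₗ[k]
        (A.weightAlgebra k).homWt k ((GammaCat.γ k d D).obj V) ⊗[k]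
          (A.weightAlgebra k).homWt k ((GammaCat.γ k d D).obj W) :=
      ∑ I : Fin d → b.ι, ∑ J : Fin d → b'.ι,
        (A.coefWt c fun i => (λ_ (𝟙_ D)).inv ≫ (b.vec (I i) ⊗ₘ b'.vec (J i))).smulRight
          ((A.symWt fun i => b.covec (I i)) ⊗ₜ[k] (A.symWt fun i => b'.covec (J i)))
    have r_apply : ∀ f, r f = ∑ I : Fin d → b.ι, ∑ J : Fin d → b'.ι,
        A.coefWt c (fun i => (λ_ (𝟙_ D)).inv ≫ (b.vec (I i) ⊗ₘ b'.vec (J i))) f •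
          ((A.symWt fun i => b.covec (I i)) ⊗ₜ[k] (A.symWt fun i => b'.covec (J i))) := fun f => by
      simp only [r, LinearMap.sum_apply, LinearMap.smulRight_apply]
    have hr : r ∘ₗ (A.weightAlgebra k).pair k _ _ = LinearMap.id := by
      refine TensorProduct.ext' fun f g => (r_apply _).trans ?_
      refine Eq.trans ?_ (congrArg₂ (fun x y => x ⊗ₜ[k] y) (A.homWt_eq_sum hc b f)
        (A.homWt_eq_sum hc b' g)).symm
      rw [TensorProduct.sum_tmul]
      refine Finset.sum_congr rfl fun I _ => ?_
      rw [TensorProduct.tmul_sum]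
      refine Finset.sum_congr rfl fun J _ => ?_
      rw [TensorProduct.smul_tmul_smul]
      exact congrArg (· • _) (A.coef_pair hc _ _ f.1.1 g.1.1)
    exact Function.LeftInverse.injective (g := r) fun t => LinearMap.congr_fun hr t
  · intro f
    rw [← LinearMap.mem_range]
    rw [A.homWt_eq_sum (V := V ⊗ W) hc (b.tensor b') f]
    refine Submodule.sum_mem _ fun I _ => Submodule.smul_mem _ _ ?_
    exact ⟨_, A.pair_symWt (fun i => b.covec (I i).1) fun i => b'.covec (I i).2⟩

theorem coefWt_symWt_id {c : (𝟙_ D ⟶ 𝟙_ D) ≃ₗ[k] k} (hc : c (𝟙 _) = 1) :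
    A.coefWt c (fun _ => 𝟙 (𝟙_ D)) (A.symWt fun _ => 𝟙 (𝟙_ D)) = (1 : k) := by
  refine (congrArg (A.coef c _) (symmetrize_val _)).trans ?_
  simp only [map_sum, permute_tprod, coef_tprod]
  rw [Fintype.sum_eq_single 1]
  · simp [hc]
  · intro σ hσ
    obtain ⟨i, hi⟩ : ∃ i, σ i ≠ i := DFunLike.exists_ne hσ
    exact Finset.prod_eq_zero (Finset.mem_univ i) (by simp [A.inj_proj_ne _ _ hi])

theorem unitMap_apply (r : k) :
    (A.weightAlgebra k).unitMap k r = r • A.symWt fun _ => 𝟙 (𝟙_ D) := by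
  refine congrArg (fun t : (A.weightAlgebra k).homWt k (𝟙_ (GammaCat k d D)) => r • t)
    (Subtype.ext ?_)
  refine (γ_symHom A.one _).trans (congrArg (symHom k d) (funext fun i => ?_))
  rw [← Category.assoc, A.one_proj]

theorem unitMap_bijective {c : (𝟙_ D ⟶ 𝟙_ D) ≃ₗ[k] k} (hc : c (𝟙 _) = 1) :
    Function.Bijective ((A.weightAlgebra k).unitMap k) := by
  constructor
  · refine Function.LeftInverse.injective (g := A.coefWt c fun _ => 𝟙 (𝟙_ D)) fun r => ?_
    refine (congrArg _ (A.unitMap_apply r)).trans ((map_smul (A.coefWt c _) r _).trans ?_)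
    rw [A.coefWt_symWt_id hc, smul_eq_mul, _root_.mul_one]
  · intro f
    refine ⟨A.coefWt c (fun _ => 𝟙 (𝟙_ D)) f, (A.unitMap_apply _).trans ?_⟩
    refine ((A.homWt_eq_sum (V := 𝟙_ D) hc (UnitDualBasis.unit D) f).trans ?_).symm
    exact Fintype.sum_unique (ι := Fin d → Unit) _

/-- If every object of `D` has a dual basis and `End(𝟙) = k`, then `V ↦ homWt V` is strong
monoidal. -/
theorem isStrong {c : (𝟙_ D ⟶ 𝟙_ D) ≃ₗ[k] k} (hc : c (𝟙 _) = 1)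
    (b : ∀ V : D, UnitDualBasis V) : (A.weightAlgebra k).IsStrong k where
  pair_bijective V W := A.pair_bijective hc (b V.as) (b W.as)
  unitMap_bijective := A.unitMap_bijective hc

end UnitPower

/-! ### Finitely generated projective modules -/

namespace FGProj

variable (k : Type u) [CommRing k]

/-- The endomorphism ring of the tensor unit `k` is `k`. -/
def unitEnd : (𝟙_ (FGProj k) ⟶ 𝟙_ (FGProj k)) ≃ₗ[k] k where
  toFun f := f.hom.hom (1 : k)
  invFun r := ObjectProperty.homMk (ModuleCat.ofHom (LinearMap.toSpanSingleton k k r))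
  map_add' _ _ := rfl
  map_smul' _ _ := rfl
  left_inv f := by
    refine ObjectProperty.hom_ext _ (ModuleCat.hom_ext (LinearMap.ext_ring ?_))
    exact one_smul k _
  right_inv r := one_smul k r

theorem unitEnd_id : unitEnd k (𝟙 _) = 1 := rfl

variable {k}

/-- The morphism `k ⟶ V` given by an element of `V`. -/
def ofElt (V : FGProj k) : V.obj →ₗ[k] (𝟙_ (FGProj k) ⟶ V) where
  toFun v := ObjectProperty.homMk (ModuleCat.ofHom (LinearMap.toSpanSingleton k V.obj v))
  map_add' v w := by
    refine ObjectProperty.hom_ext _ (ModuleCat.hom_ext (LinearMap.ext_ring ?_))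
    exact (one_smul k (v + w)).trans (congrArg₂ (· + ·) (one_smul k v) (one_smul k w)).symm
  map_smul' r v := by
    refine ObjectProperty.hom_ext _ (ModuleCat.hom_ext (LinearMap.ext_ring ?_))
    exact (one_smul k (r • v)).trans (congrArg (r • ·) (one_smul k v)).symm

theorem ofElt_comp {V W : FGProj k} (v : V.obj) (f : V ⟶ W) :
    ofElt V v ≫ f = ofElt W (f.hom.hom v) :=
  ObjectProperty.hom_ext _ <| ModuleCat.hom_ext <| LinearMap.ext fun r => map_smul f.hom.hom r v

/-- A functional on `V` as a morphism to the tensor unit. -/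
def ofDual (V : FGProj k) (f : V.obj →ₗ[k] k) : V ⟶ 𝟙_ (FGProj k) :=
  ObjectProperty.homMk (ModuleCat.ofHom f)

theorem sum_apply {V W : FGProj k} {ι : Type*} [Fintype ι] (f : ι → (V ⟶ W)) (v : V.obj) :
    (∑ j, f j).hom.hom v = ∑ j, (f j).hom.hom v :=
  map_sum ((evalBilin V W).flip v) f Finset.univ

theorem nonempty_dualBasis (V : FGProj k) : Nonempty (UnitDualBasis V) := by
  have := V.property.1
  have := V.property.2
  obtain ⟨n, f, g, -, -, h⟩ := Module.Finite.exists_comp_eq_id_of_projective k V.obj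
  refine ⟨⟨Fin n, inferInstance, fun j => ofElt V (f (Pi.single j 1)),
    fun j => ofDual V (LinearMap.proj j ∘ₗ g), ?_⟩⟩
  refine ObjectProperty.hom_ext _ (ModuleCat.hom_ext (LinearMap.ext fun v => ?_))
  have h₁ : ∑ j, g v j • f (Pi.single j 1) = v := by
    have h₂ : f (g v) = v := LinearMap.congr_fun h v
    conv_rhs => rw [← h₂, pi_eq_sum_univ' (g v), map_sum]
    refine Finset.sum_congr rfl fun j _ => ?_
    rw [map_smul]
  exact (sum_apply _ v).trans h₁

variable (k) (d : ℕ)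

/-- The free module `k^d` as a power of the tensor unit. -/
def stdPower : UnitPower (FGProj k) d where
  E := ⟨ModuleCat.of k (Fin d → k), inferInstanceAs (Module.Finite k (Fin d → k)),
    inferInstanceAs (Module.Projective k (Fin d → k))⟩
  inj i := ObjectProperty.homMk (ModuleCat.ofHom (LinearMap.single k (fun _ => k) i))
  proj i := ObjectProperty.homMk (ModuleCat.ofHom (LinearMap.proj i))
  inj_proj_self i := by
    refine ObjectProperty.hom_ext _ (ModuleCat.hom_ext (LinearMap.ext fun r => ?_))
    exact Pi.single_eq_same (M := fun _ => k) i r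
  inj_proj_ne i j h := by
    refine ObjectProperty.hom_ext _ (ModuleCat.hom_ext (LinearMap.ext fun r => ?_))
    exact Pi.single_eq_of_ne (M := fun _ => k) h.symm r
  total := by
    refine ObjectProperty.hom_ext _ (ModuleCat.hom_ext (LinearMap.ext fun x => ?_))
    exact (sum_apply _ x).trans (Finset.univ_sum_single (M := fun _ => k) x)

end FGProj

/-! ### The Yoneda lemma for `Γ^ω` -/

open LinRep

section Yoneda

variable {k : Type u} [CommRing k] {d : ℕ}

variable (k d) in
/-- The weight algebra in `Γ^d P_k` whose underlying object is `k^d`. -/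
def stdWeight : WeightAlgebra (DivPow k d) (Equiv.Perm (Fin d)) :=
  (FGProj.stdPower k d).weightAlgebra k

theorem stdWeight_isStrong : (stdWeight k d).IsStrong k :=
  (FGProj.stdPower k d).isStrong (FGProj.unitEnd_id k)
    fun V => (FGProj.nonempty_dualBasis V).some

/-- The morphism `Sym(∏ pᵢ · vᵢ)` from `k^d` to `V` in the category of divided powers given by a
tensor `v₁ ⊗ ⋯ ⊗ v_d`, where `pᵢ` are the coordinate functions of `k^d`. -/
def homOfTensor (V : FGProj k) :
    (⨂[k] _ : Fin d, V.obj) →ₗ[k] dividedPower k d ((FGProj.stdPower k d).E ⟶ V) :=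
  symmetrize k d _ ∘ₗ PiTensorProduct.map fun i =>
    Linear.leftComp k V ((FGProj.stdPower k d).proj i) ∘ₗ FGProj.ofElt V

theorem homOfTensor_tprod (V : FGProj k) (v : Fin d → V.obj) :
    homOfTensor V (PiTensorProduct.tprod k v) = symmetrize k d _ (PiTensorProduct.tprod k fun i =>
      (FGProj.stdPower k d).proj i ≫ FGProj.ofElt V (v i)) := by
  rw [homOfTensor, LinearMap.comp_apply, PiTensorProduct.map_tprod]
  rfl

/-- Naturality of the morphism given by a tensor, before symmetrization. -/
theorem powMap₂_comp_map {E V W : FGProj k} (p : Fin d → (E ⟶ 𝟙_ (FGProj k)))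
    (t : ⨂[k] _ : Fin d, V.obj) (y : ⨂[k] _ : Fin d, (V ⟶ W)) :
    powMap₂ d (GammaCat.compBilin (k := k) E V W)
        (PiTensorProduct.map (fun i => Linear.leftComp k V (p i) ∘ₗ FGProj.ofElt V) t) y =
      PiTensorProduct.map (fun i => Linear.leftComp k W (p i) ∘ₗ FGProj.ofElt W)
        (powMap₂ d (evalBilin V W) y t) := by
  induction t using PiTensorProduct.induction_on with
  | add x₁ x₂ h₁ h₂ => simp only [map_add, LinearMap.add_apply, h₁, h₂]
  | smul_tprod r a =>
  induction y using PiTensorProduct.induction_on with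
  | add x₁ x₂ h₁ h₂ => simp only [map_add, LinearMap.add_apply, h₁, h₂]
  | smul_tprod s b =>
    simp only [map_smul, LinearMap.smul_apply, PiTensorProduct.map_tprod, powMap₂_tprod]
    rw [smul_comm]
    refine congrArg (fun t => r • s • PiTensorProduct.tprod k t) (funext fun i => ?_)
    exact (Category.assoc _ _ _).trans (congrArg (p i ≫ ·) (FGProj.ofElt_comp (a i) (b i)))

/-- `homOfTensor` as a morphism. -/
abbrev tensorHomOf {V : DivPow k d} (t : (Gω k d).obj.obj V) : (stdWeight k d).E ⟶ V :=
  homOfTensor V.as t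

theorem tensorHomOf_comp {V W : DivPow k d} (t : (Gω k d).obj.obj V) (f : V ⟶ W) :
    tensorHomOf t ≫ f = tensorHomOf ((Gω k d).act f t) :=
  Subtype.ext <| (powMap₂_symmetrize_left _ _ f.2).trans <|
    congrArg (fun s => (symmetrize k d ((FGProj.stdPower k d).E ⟶ W.as) s).1)
      (powMap₂_comp_map (FGProj.stdPower k d).proj t f.1)

variable (k d) in
/-- The tensor `b₁ ⊗ ⋯ ⊗ b_d` of the standard basis elements of `k^d`. -/
def stdTensor : (Gω k d).obj.obj (stdWeight k d).E :=
  PiTensorProduct.tprod k fun i : Fin d => (Pi.single i 1 : Fin d → k)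

theorem ofElt_single (i : Fin d) :
    FGProj.ofElt (FGProj.stdPower k d).E (Pi.single i 1 : Fin d → k) =
      (FGProj.stdPower k d).inj i := by
  refine ObjectProperty.hom_ext _ (ModuleCat.hom_ext (LinearMap.ext fun r => ?_))
  exact (Pi.single_smul (f := fun _ => k) i r 1).symm.trans
    (congrArg (Pi.single i) (_root_.mul_one r))

theorem tensorHomOf_stdTensor : tensorHomOf (stdTensor k d) = (stdWeight k d).e := by
  refine (homOfTensor_tprod _ _).trans (congrArg (symHom k d) (funext fun i => ?_))
  exact congrArg ((FGProj.stdPower k d).proj i ≫ ·) (ofElt_single i)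

theorem powMap₂_eval_single (V : FGProj k) (t : ⨂[k] _ : Fin d, V.obj) :
    powMap₂ d (evalBilin (FGProj.stdPower k d).E V) (homOfTensor V t).1
      (PiTensorProduct.tprod k fun i : Fin d => (Pi.single i 1 : Fin d → k)) = t := by
  induction t using PiTensorProduct.induction_on with
  | add x₁ x₂ h₁ h₂ =>
    simp only [map_add, Submodule.coe_add, LinearMap.add_apply, h₁, h₂]
  | smul_tprod r v =>
    simp only [map_smul, Submodule.coe_smul, LinearMap.smul_apply, homOfTensor_tprod]
    refine congrArg (r • ·) ((powMap₂_symmetrize_tprod _ _ _ fun i j h => ?_).trans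
      (congrArg _ (funext fun i => ?_)))
    · exact (congrArg (· • v i) (Pi.single_eq_of_ne (M := fun _ => k) h 1)).trans (zero_smul k _)
    · exact (congrArg (· • v i) (Pi.single_eq_same (M := fun _ => k) i 1)).trans (one_smul k _)

theorem act_stdTensor {V : DivPow k d} (t : (Gω k d).obj.obj V) :
    (Gω k d).act (tensorHomOf t) (stdTensor k d) = t :=
  powMap₂_eval_single V.as t

theorem act_e_stdTensor : (Gω k d).act (stdWeight k d).e (stdTensor k d) = stdTensor k d := by
  rw [← tensorHomOf_stdTensor]
  exact act_stdTensor _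

/-- The Yoneda lemma for `Γ^ω`: evaluation at `b₁ ⊗ ⋯ ⊗ b_d` identifies the morphisms
from `Γ^ω` to `X` with the weight space of `X`. -/
def homEquivWt (X : StrictPolyFunctor k d) : (Gω k d ⟶ X) ≃ₗ[k] (stdWeight k d).wt X where
  toFun f := ⟨ap f (stdTensor k d), by
    rw [WeightAlgebra.mem_wt, ← ap_act, act_e_stdTensor]⟩
  map_add' _ _ := rfl
  map_smul' _ _ := rfl
  invFun x := ofLinear
    (fun V =>
      { toFun := fun t => X.act (tensorHomOf (V := V) t) x.1
        map_add' := fun s t => (congrArg (X.act · x.1) (map_add (homOfTensor V.as) s t)).trans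
          (add_act _ _ _)
        map_smul' := fun r t => (congrArg (X.act · x.1) (map_smul (homOfTensor V.as) r t)).trans
          (smul_act _ _ _) })
    (fun g t => by
      show X.act (tensorHomOf _) x.1 = X.act g (X.act (tensorHomOf t) x.1)
      rw [← act_comp, tensorHomOf_comp])
  left_inv f := hom_ext fun V t => by
    show X.act (tensorHomOf t) (ap f (stdTensor k d)) = ap f t
    rw [← ap_act, act_stdTensor]
  right_inv x := Subtype.ext <| by
    show X.act (tensorHomOf (stdTensor k d)) x.1 = x.1
    rw [tensorHomOf_stdTensor]
    exact x.2

theorem act_s_stdTensor (σ : Equiv.Perm (Fin d)) :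
    (Gω k d).act ((stdWeight k d).s σ) (stdTensor k d) =
      ap (permGω k d σ) (stdTensor k d) := by
  refine (powMap₂_tprod d (evalBilin (FGProj.stdPower k d).E (FGProj.stdPower k d).E)
    (fun _ => (FGProj.stdPower k d).perm σ) fun i : Fin d => (Pi.single i 1 : Fin d → k)).trans ?_
  refine Eq.trans (congrArg (PiTensorProduct.tprod k) (funext fun i => ?_))
    (permute_tprod d σ fun i : Fin d => (Pi.single i 1 : Fin d → k)).symm
  -- apply `inj i ≫ perm σ = inj (σ i)` to `1`
  exact congrArg (fun f : 𝟙_ (FGProj k) ⟶ (FGProj.stdPower k d).E => f.hom.hom (1 : k))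
    ((FGProj.stdPower k d).inj_perm σ i)

theorem homEquivWt_homAction (X : StrictPolyFunctor k d) (σ : Equiv.Perm (Fin d))
    (f : Gω k d ⟶ X) :
    homEquivWt X (homAction k d X σ f) = (stdWeight k d).wtRep X σ (homEquivWt X f) :=
  Subtype.ext <| by
    show ap f (ap (permGω k d σ) (stdTensor k d)) =
      X.act ((stdWeight k d).s σ) (ap f (stdTensor k d))
    rw [← act_s_stdTensor, ap_act]

/-- The module `Hom(Γ^ω, X)` is isomorphic to the weight space of `X`, as a representation of the
symmetric group. -/
def schurRepEquiv (X : StrictPolyFunctor k d) :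
    (schurRep k d X).Equiv ((stdWeight k d).wtRep X) :=
  .mk (Shrink.linearEquiv k (Gω k d ⟶ X) ≪≫ₗ homEquivWt X) fun σ => LinearMap.ext fun f => by
    refine Eq.trans ?_ (homEquivWt_homAction X σ (Shrink.linearEquiv k _ f))
    simp [schurRep]

variable (k d) in
/-- The functor `Hom(Γ^ω, -)` is isomorphic to the weight space functor. -/
def schurIso : schurFunctor k d ≅ (stdWeight k d).wtFunctor k :=
  NatIso.ofComponents (fun X => Rep.mkIso (schurRepEquiv X)) fun {X Y} φ =>
    Rep.hom_ext <| Representation.IntertwiningMap.ext <| LinearMap.ext fun f => Subtype.ext <| by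
      show ap (Shrink.linearEquiv k _ ((Shrink.linearEquiv k _).symm
        (Shrink.linearEquiv k _ f ≫ φ))) _ = ap φ (ap (Shrink.linearEquiv k _ f) _)
      rw [LinearEquiv.apply_symm_apply, ap_comp]

end Yoneda

end SPF

end

/-- For `d ≥ 1` the functor `Hom(Γ^ω, -)` from strict polynomial functors of degree `d` over `k`, with
the internal tensor product, to modules over the group algebra of the symmetric group, with the
diagonal tensor product over `k`, is (strong) monoidal. -/
theorem theorem3p4 (k : Type u) [CommRing k] (d : ℕ) [NeZero d] :
    Nonempty (SPF.schurFunctor k d).Monoidal := by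
  let F := (SPF.stdWeight k d).wtFunctor k
  let _ : F.Monoidal := (SPF.WeightAlgebra.coreMonoidal SPF.stdWeight_isStrong).toMonoidal
  exact ⟨Functor.Monoidal.transport (F := F) (SPF.schurIso k d).symm⟩
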